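/- Let $K$ be the number of colors. On a probability space consider a random initial composition $\mathbf{C}_0=(C_{01},\dots,C_{0K})$, and for each trial $n\ge 1$ a random indicator row vector $\boldsymbol\chi_n\in\{\mathbf e_1,\dots,\mathbf e_K\}$ ($\boldsymbol\chi_n=\mathbf e_i$ if color $i$ is drawn) and a random $K\times K$ replacement matrix $\mathbf R_n$ with nonnegative entries. Put $$\mathbf C_n=\mathbf C_{n-1}+\boldsymbol\chi_n\mathbf R_n,\qquad S_n=\sum_{i=1}^K C_{ni},\qquad \mathbf N_n=\sum_{k=1}^n\boldsymbol\chi_k\qquad(n\ge1),$$ $S_0=\sum_i C_{0i}$, and let $\mathcal F_n$ be the $\sigma$-field generated by $\mathbf C_0$ and $(\mathbf R_m,\boldsymbol\chi_m)_{1\le m\le n}$. For a matrix $\mathbf A$ let $\|\mathbf A\|=\max_i\sum_j|A_{ij}|$. Let $\widetilde{\mathbf H}_{n-1}=E\big[\mathbf R_n\mathbf 1_{\{\|\mathbf R_n\|\le n\}}\,\big|\,\mathcal F_{n-1}\big]$, $n\ge1$, be the truncated generating matrices. Assume the following. (1) $\mathbf C_0$ is nonzero, has nonnegative entries and has finite mean;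 $P(\boldsymbol\chi_n=\mathbf e_i\mid\mathcal F_{n-1})=C_{n-1,i}/S_{n-1}$ for all $n\ge1$ and all $i$; and, for all $n\ge1$, $\boldsymbol\chi_n$ and $\mathbf R_n$ are conditionally independent given $\mathcal F_{n-1}$. (2) At least one of the following holds: (a) there are $c\in(0,\infty)$ and a positive random variable $R$ with $E[R]<\infty$ (possibly on another probability space) such that $P(\|\mathbf R_n\|>x)\le c\,P(R>x)$ for all $n\ge1$ and all $x>0$; (b) there is a (measurable) function $\phi:[0,\infty)\to[0,\infty)$, eventually positive and nondecreasing, with $x/\phi(x)$ eventually nondecreasing and $\sum_n 1/(n\phi(n))<\infty$ (the sum being taken over the $n\ge 1$ with $\phi(n)>0$), such that $\sup_{n\ge1}E\big[\|\mathbf R_n\|\,\phi(\|\mathbf R_n\|)\big]<\infty$. (3) There is a (possibly random) $K\times K$ matrix $\mathbf H$ that is almost surely nonnegative and irreducible (for all $i,j$ there is $N\ge1$ with $(\mathbf H^N)_{ij}>0$) such that $$\frac1n\sum_{k=0}^{n-1}\big\|\widetilde{\mathbf H}_k-\mathbf H\big\|\to0\quad\text{almost surely.}$$ Then almost surely $\mathbf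 H$ has a real eigenvalue $\lambda_{\mathbf H}$ whose real part is strictly larger than that of every other complex eigenvalue (the dominant eigenvalue), there is a unique left eigenvector $\boldsymbol\pi_{\mathbf H}$ of $\mathbf H$ for $\lambda_{\mathbf H}$ that has strictly positive coordinates and is a probability vector, and, as $n\to\infty$, $$\frac{\mathbf C_n}{S_n}\to\boldsymbol\pi_{\mathbf H},\qquad \frac{S_n}{n}\to\lambda_{\mathbf H},\qquad \frac{\mathbf C_n}{n}\to\lambda_{\mathbf H}\boldsymbol\pi_{\mathbf H},\qquad \frac{\mathbf N_n}{n}\to\boldsymbol\pi_{\mathbf H},$$ each both almost surely and in $L^1$. -/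

import Mathlib

open MeasureTheory ProbabilityTheory Filter Topology
open scoped NNReal ENNReal Matrix

/- The norm of a matrix is `‖A‖ = max_i ∑_j |A i j|`. -/
attribute [local instance] Matrix.linftyOpNormedAddCommGroup

instance instMeasurableSpaceMatrix {m n α : Type*} [MeasurableSpace α] :
    MeasurableSpace (Matrix m n α) :=
  inferInstanceAs (MeasurableSpace (m → n → α))

namespace RandomUrn

noncomputable section

variable {Ω : Type*} {K : ℕ}

/-- The indicator (row) vector `χ_n = e_{J n}` of the color `J n` drawn in the `n`-th trial. -/
def colorIndicator (J : ℕ → Ω → Fin K) (n : ℕ) (ω : Ω) : Fin K → ℝ :=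
  Pi.single (J n ω) 1

/-- The composition vector: `C_n = C_{n-1} + χ_n R_n` for `n ≥ 1`. Trials are numbered from `1`,
so that the values of `J` and `R` at index `0` are never used. -/
def composition (C₀ : Ω → Fin K → ℝ) (J : ℕ → Ω → Fin K)
    (R : ℕ → Ω → Matrix (Fin K) (Fin K) ℝ) : ℕ → Ω → Fin K → ℝ
  | 0 => C₀
  | n + 1 => fun ω =>
      composition C₀ J R n ω + colorIndicator J (n + 1) ω ᵥ* R (n + 1) ω

/-- The total content `S_n = ∑_i C_{n,i}` of the urn. -/
def totalContent (C₀ : Ω → Fin K → ℝ) (J : ℕ → Ω → Fin K)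
    (R : ℕ → Ω → Matrix (Fin K) (Fin K) ℝ) (n : ℕ) (ω : Ω) : ℝ :=
  ∑ i, composition C₀ J R n ω i

/-- The count vector `N_n = ∑_{k=1}^n χ_k`. -/
def colorCount (J : ℕ → Ω → Fin K) (n : ℕ) (ω : Ω) : Fin K → ℝ :=
  ∑ k ∈ Finset.Icc 1 n, colorIndicator J k ω

/-- The σ-field `F_n` generated by `C₀` and `(R_m, χ_m)`, `1 ≤ m ≤ n`. -/
abbrev past (C₀ : Ω → Fin K → ℝ) (J : ℕ → Ω → Fin K)
    (R : ℕ → Ω → Matrix (Fin K) (Fin K) ℝ) (n : ℕ) : MeasurableSpace Ω :=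
  MeasurableSpace.comap C₀ inferInstance ⊔
    ⨆ m ∈ Finset.Icc 1 n,
      (MeasurableSpace.comap (R m) inferInstance ⊔
        MeasurableSpace.comap (colorIndicator J m) inferInstance)

lemma measurable_colorIndicator {mΩ : MeasurableSpace Ω} {J : ℕ → Ω → Fin K} {n : ℕ}
    (hJ : Measurable (J n)) : Measurable (colorIndicator J n) :=
  (measurable_of_finite (fun i : Fin K => (Pi.single i 1 : Fin K → ℝ))).comp hJ

lemma past_le {mΩ : MeasurableSpace Ω} {C₀ : Ω → Fin K → ℝ} {J : ℕ → Ω → Fin K}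
    {R : ℕ → Ω → Matrix (Fin K) (Fin K) ℝ} (hC : Measurable C₀)
    (hJ : ∀ n, 1 ≤ n → Measurable (J n)) (hR : ∀ n, 1 ≤ n → Measurable (R n)) (n : ℕ) :
    past C₀ J R n ≤ mΩ := by
  refine sup_le hC.comap_le (iSup₂_le fun m hm => ?_)
  have h1 : 1 ≤ m := (Finset.mem_Icc.1 hm).1
  exact sup_le (hR m h1).comap_le (measurable_colorIndicator (hJ m h1)).comap_le

/-- The truncated generating matrix `E[R_{n+1} 1{‖R_{n+1}‖ ≤ n+1} | F_n]`, entry by entry. -/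
def truncGenerating {mΩ : MeasurableSpace Ω} (μ : Measure Ω) (C₀ : Ω → Fin K → ℝ)
    (J : ℕ → Ω → Fin K) (R : ℕ → Ω → Matrix (Fin K) (Fin K) ℝ) (n : ℕ) (ω : Ω) :
    Matrix (Fin K) (Fin K) ℝ :=
  Matrix.of fun i j =>
    (μ[{ω' | ‖R (n + 1) ω'‖ ≤ (n + 1 : ℕ)}.indicator (fun ω' => R (n + 1) ω' i j) |
      past C₀ J R n]) ω

/-- Conditional independence of `f` and `g` given the σ-field `m`, on an arbitrary probability
space: `P(f ∈ A, g ∈ B | m) = P(f ∈ A | m) P(g ∈ B | m)` almost surely, for all measurable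
`A`, `B`. -/
def CondIndependent {β γ : Type*} [MeasurableSpace β] [MeasurableSpace γ]
    {mΩ : MeasurableSpace Ω} (μ : Measure Ω) (m : MeasurableSpace Ω) (f : Ω → β) (g : Ω → γ) :
    Prop :=
  ∀ A B, MeasurableSet A → MeasurableSet B →
    μ⟦f ⁻¹' A ∩ g ⁻¹' B | m⟧ =ᵐ[μ] fun ω => (μ⟦f ⁻¹' A | m⟧) ω * (μ⟦g ⁻¹' B | m⟧) ω

/-- The randomized urn model: random variables `C₀`, `J n`, `R n` (`n ≥ 1`) with nonnegative
replacement matrices such that the initial configuration is nonzero, nonnegative and has finite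
mean; given `F_{n-1}`, color `i` is drawn with probability `C_{n-1,i} / S_{n-1}`; and, given
`F_{n-1}`, the draw `χ_n` and the replacement matrix `R_n` are independent. -/
structure IsRandomizedUrn {mΩ : MeasurableSpace Ω} (μ : Measure Ω) (C₀ : Ω → Fin K → ℝ)
    (J : ℕ → Ω → Fin K) (R : ℕ → Ω → Matrix (Fin K) (Fin K) ℝ) : Prop where
  measurable_init : Measurable C₀
  measurable_draw : ∀ n, 1 ≤ n → Measurable (J n)
  measurable_replacement : ∀ n, 1 ≤ n → Measurable (R n)
  replacement_nonneg : ∀ n, 1 ≤ n → ∀ᵐ ω ∂μ, ∀ i j, 0 ≤ R n ω i j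
  init_nonneg : ∀ᵐ ω ∂μ, ∀ i, 0 ≤ C₀ ω i
  init_ne_zero : ∀ᵐ ω ∂μ, C₀ ω ≠ 0
  init_integrable : ∀ i, Integrable (fun ω => C₀ ω i) μ
  draw_prob : ∀ n, ∀ i,
    μ⟦colorIndicator J (n + 1) ⁻¹' {Pi.single i 1} | past C₀ J R n⟧ =ᵐ[μ]
      fun ω => composition C₀ J R n ω i / totalContent C₀ J R n ω
  draw_condIndep : ∀ n,
    CondIndependent μ (past C₀ J R n) (colorIndicator J (n + 1)) (R (n + 1))

/-- The norms `‖R_n‖`, `n ≥ 1`, are majorized: `P(‖R_n‖ > x) ≤ c P(X > x)` for all `x > 0`, for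
some constant `c > 0` and some positive random variable `X` with finite mean (given here through
its law `ν` on `ℝ`, since it may live on another probability space). -/
def NormsMajorized {mΩ : MeasurableSpace Ω} (μ : Measure Ω)
    (R : ℕ → Ω → Matrix (Fin K) (Fin K) ℝ) : Prop :=
  ∃ c : ℝ, 0 < c ∧ ∃ ν : Measure ℝ, IsProbabilityMeasure ν ∧ ν (Set.Iic 0) = 0 ∧
    Integrable (fun x => x) ν ∧
    ∀ n, 1 ≤ n → ∀ x : ℝ, 0 < x → μ.real {ω | x < ‖R n ω‖} ≤ c * ν.real (Set.Ioi x)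

/-- `sup_{n ≥ 1} E[‖R_n‖ φ(‖R_n‖)] < ∞` for some `φ : [0, ∞) → [0, ∞)` that is eventually
positive and nondecreasing, with `x / φ x` eventually nondecreasing and `∑ 1 / (n φ(n)) < ∞`.
(The finitely many `n` with `n φ(n) = 0` contribute `0` to the sum.) -/
def NormsMomentBounded {mΩ : MeasurableSpace Ω} (μ : Measure Ω)
    (R : ℕ → Ω → Matrix (Fin K) (Fin K) ℝ) : Prop :=
  ∃ φ : ℝ≥0 → ℝ≥0, Measurable φ ∧
    (∃ x₀ : ℝ≥0, (∀ x, x₀ ≤ x → 0 < φ x) ∧ MonotoneOn φ (Set.Ici x₀) ∧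
      MonotoneOn (fun x => x / φ x) (Set.Ici x₀)) ∧
    Summable (fun n : ℕ => 1 / ((n : ℝ≥0) * φ n)) ∧
    ⨆ n : ℕ, ∫⁻ ω, ((‖R (n + 1) ω‖₊ * φ ‖R (n + 1) ω‖₊ : ℝ≥0) : ℝ≥0∞) ∂μ < ∞

/-- The dominant eigenvalue of a real matrix: the largest real part of a complex eigenvalue. -/
def dominantEigenvalue (A : Matrix (Fin K) (Fin K) ℝ) : ℝ :=
  sSup (Complex.re '' spectrum ℂ (A.map Complex.ofReal))

/-- `lam` is the eigenvalue of `A` having the largest real part. -/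
def IsDominantEigenvalue (A : Matrix (Fin K) (Fin K) ℝ) (lam : ℝ) : Prop :=
  (lam : ℂ) ∈ spectrum ℂ (A.map Complex.ofReal) ∧
    ∀ z ∈ spectrum ℂ (A.map Complex.ofReal), z ≠ (lam : ℂ) → z.re < lam

/-- `v` is a left eigenvector of `A` for the dominant eigenvalue, has strictly positive
coordinates, and is a probability vector. -/
def IsPerronVector (A : Matrix (Fin K) (Fin K) ℝ) (v : Fin K → ℝ) : Prop :=
  v ᵥ* A = dominantEigenvalue A • v ∧ (∀ i, 0 < v i) ∧ ∑ i, v i = 1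

open Classical in
/-- The left Perron–Frobenius probability vector `π_A` (the zero vector if there is none). -/
def perronVector (A : Matrix (Fin K) (Fin K) ℝ) : Fin K → ℝ :=
  if h : ∃ v, IsPerronVector A v then h.choose else 0

/-- `X_n → Y` almost surely as well as in `L¹`. -/
def TendstoAEAndL1 {E : Type*} [NormedAddCommGroup E] {mΩ : MeasurableSpace Ω} (μ : Measure Ω)
    (X : ℕ → Ω → E) (Y : Ω → E) : Prop :=
  (∀ᵐ ω ∂μ, Tendsto (fun n => X n ω) atTop (𝓝 (Y ω))) ∧
    (∀ n, Integrable (X n) μ) ∧ Integrable Y μ ∧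
    Tendsto (fun n => eLpNorm (X n - Y) 1 μ) atTop (𝓝 0)

end

end RandomUrn

/-!
The urn is compared with a deterministic recursion. Write `y k = C k / S k` for the color
frequencies. Given the past, color `i` is drawn with probability `y k i` independently of the
replacement, so the predicted increment of the composition, after truncation of the replacement at
level `k + 1`, is `y k` times the truncated generating matrix
(`CondIndependent.condExp_indicator_mul`). Either tail assumption makes truncation harmless and the
second moments of the truncated replacements summable against `k⁻²` (`TailControl`), so a strong law
for martingale differences (`ae_tendsto_average_sub_condExp`) and the Cesàro convergence of the
generating matrices to `H` give, almost surely,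
`C n = (∑ k < n, y k) H + o(n)` and `N n = ∑ k < n, y k + o(n)`.

The rest of the almost sure statement is deterministic. An irreducible nonnegative matrix has
positive left and right eigenvectors `p`, `r` with `p ⬝ᵥ r = 1` for an eigenvalue `lam` that bounds
the modulus of every eigenvalue (`IsIrreducible.exists_isPerronTriple`, by the Collatz–Wielandt
argument). With `A n = ∑ k < n, y k`, the vector `w n = A n / (A n ⬝ᵥ r) - p` satisfies
`w (n + 1) = w n + γ n (w n (H - lam) + o(1))` with steps `γ n` of order `1 / n`, and
stays in the hyperplane orthogonal to `r`. There the quadratic form `∑ i, (r i / p i) w i ^ 2` decays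
at a linear rate, because its derivative along `w (H - lam)` is a negative Dirichlet form whose only
null vectors are constants (`IsPerronTriple.exists_gap`). Hence `w n → 0`
(`IsPerronTriple.tendsto_average`), so `A n / n` converges to the Perron vector `π` and `C n / n` to
`lam π`; the other limits follow.

For convergence in mean, all four sequences are dominated by an integrable function plus the
averages of the uniformly integrable norms `‖R k‖`, and Vitali's theorem applies
(`tendstoAEAndL1_of_norm_le`).
-/

/-! ### Perron–Frobenius theory for irreducible matrices -/

namespace Matrix

section Perron

variable {ι : Type*} [Fintype ι] {A : Matrix ι ι ℝ}

/-- A finite sum of powers of an irreducible matrix `A` is entrywise positive. Such a sum commutes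
with `A` and so turns nonzero nonnegative vectors into positive ones without disturbing the
relations that involve `A`. -/
lemma IsIrreducible.exists_sum_pow_pos [DecidableEq ι] (hA : A.IsIrreducible) :
    ∃ N : ℕ, ∀ i j, 0 < (∑ k ∈ Finset.range N, A ^ k) i j := by
  have h := (isIrreducible_iff_exists_pow_pos hA.nonneg).1 hA
  choose k _ hk using h
  refine ⟨(∑ i, ∑ j, k i j) + 1, fun i j => ?_⟩
  rw [Matrix.sum_apply]
  refine Finset.sum_pos' (fun m _ => pow_apply_nonneg hA.nonneg m i j) ⟨k i j, ?_, hk i j⟩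
  have h1 : k i j ≤ ∑ j, k i j :=
    Finset.single_le_sum (f := fun j => k i j) (fun _ _ => Nat.zero_le _) (Finset.mem_univ j)
  have h2 : ∑ j, k i j ≤ ∑ i, ∑ j, k i j :=
    Finset.single_le_sum (f := fun i => ∑ j, k i j) (fun _ _ => Nat.zero_le _) (Finset.mem_univ i)
  exact Finset.mem_range.2 (by omega)

lemma mulVec_pos_of_pos {B : Matrix ι ι ℝ} (hB : ∀ i j, 0 < B i j) {z : ι → ℝ}
    (hz : ∀ i, 0 ≤ z i) (hz0 : z ≠ 0) (i : ι) : 0 < (B *ᵥ z) i := by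
  obtain ⟨j, hj⟩ := Function.ne_iff.1 hz0
  exact Finset.sum_pos' (fun j _ => mul_nonneg (hB i j).le (hz j))
    ⟨j, Finset.mem_univ j, mul_pos (hB i j) (lt_of_le_of_ne (hz j) (Ne.symm hj))⟩

/-- The Collatz–Wielandt argument: the largest `t` for which some probability vector `x` satisfies
`t x ≤ A x` is an eigenvalue. -/
lemma IsIrreducible.exists_mulVec_eq_smul [Nonempty ι] (hA : A.IsIrreducible) :
    ∃ t : ℝ, ∃ x : ι → ℝ, (∀ i, 0 < x i) ∧ A *ᵥ x = t • x := by
  classical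
  obtain ⟨N, hN⟩ := hA.exists_sum_pow_pos
  set B := ∑ k ∈ Finset.range N, A ^ k with hB
  have hAB : Commute A B := Commute.sum_right _ _ _ fun k _ => Commute.self_pow A k
  set T : ℝ := ∑ i, ∑ j, A i j
  set S : Set ((ι → ℝ) × ℝ) :=
    {q | ∀ i, q.2 * q.1 i ≤ (A *ᵥ q.1) i} ∩ (stdSimplex ℝ ι ×ˢ Set.Icc 0 T) with hS
  have hTnn : 0 ≤ T := Finset.sum_nonneg fun i _ => Finset.sum_nonneg fun j _ => hA.nonneg i j
  have hclosed : IsClosed {q : (ι → ℝ) × ℝ | ∀ i, q.2 * q.1 i ≤ (A *ᵥ q.1) i} := by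
    simp only [Set.ofPred_forall]
    refine isClosed_iInter fun i => isClosed_le (by fun_prop) ?_
    simp only [mulVec, dotProduct]
    fun_prop
  have hcomp : IsCompact S :=
    ((isCompact_stdSimplex ℝ ι).prod isCompact_Icc).inter_left hclosed
  have hne : S.Nonempty := by
    obtain ⟨i₀⟩ := ‹Nonempty ι›
    refine ⟨(Pi.single i₀ 1, 0), fun i => ?_, single_mem_stdSimplex ℝ i₀, le_rfl, hTnn⟩
    have h0 := hA.nonneg i i₀
    simpa using h0
  obtain ⟨⟨x, t⟩, ⟨hxt, hx, ht⟩, hmax⟩ := hcomp.exists_isMaxOn hne continuous_snd.continuousOn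
  simp only at hxt hx ht
  have hx0 : x ≠ 0 := by
    rintro rfl
    simpa using hx.2
  have hBx := mulVec_pos_of_pos hN hx.1 hx0
  have heq : A *ᵥ x = t • x := by
    by_contra hcon
    have hz0 : A *ᵥ x - t • x ≠ 0 := sub_ne_zero.2 hcon
    have hz := mulVec_pos_of_pos hN (z := A *ᵥ x - t • x)
      (fun i => by simpa using hxt i) hz0
    have hcomm : B *ᵥ (A *ᵥ x - t • x) = A *ᵥ (B *ᵥ x) - t • (B *ᵥ x) := by
      rw [mulVec_sub, mulVec_smul, mulVec_mulVec, mulVec_mulVec, hAB.eq]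
    rw [hcomm] at hz
    set y := B *ᵥ x with hy
    obtain ⟨i₁, hi₁⟩ := Finite.exists_min fun i => (A *ᵥ y - t • y) i / y i
    set ε := (A *ᵥ y - t • y) i₁ / y i₁
    have hε : 0 < ε := div_pos (hz i₁) (hBx i₁)
    have hle : ∀ i, (t + ε) * y i ≤ (A *ᵥ y) i := fun i => by
      have h1 := (le_div_iff₀ (hBx i)).1 (hi₁ i)
      simp only [Pi.sub_apply, Pi.smul_apply, smul_eq_mul] at h1
      linarith
    have hs : 0 < ∑ i, y i := Finset.sum_pos (fun i _ => hBx i) Finset.univ_nonempty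
    set s := ∑ i, y i with hsdef
    have hx' : s⁻¹ • y ∈ stdSimplex ℝ ι := by
      refine ⟨fun i => by have := (hBx i).le; simp only [Pi.smul_apply, smul_eq_mul]; positivity, ?_⟩
      simp only [Pi.smul_apply, smul_eq_mul, ← Finset.mul_sum]
      exact inv_mul_cancel₀ hs.ne'
    have hle' : ∀ i, (t + ε) * (s⁻¹ • y) i ≤ (A *ᵥ (s⁻¹ • y)) i := fun i => by
      rw [mulVec_smul]
      simp only [Pi.smul_apply, smul_eq_mul]
      have := mul_le_mul_of_nonneg_left (hle i) (inv_pos.2 hs).le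
      linarith
    have hT : t + ε ≤ T := by
      have h1 := Finset.sum_le_sum fun i (_ : i ∈ Finset.univ) => hle' i
      rw [← Finset.mul_sum, hx'.2, mul_one] at h1
      refine h1.trans (Finset.sum_le_sum fun i _ => Finset.sum_le_sum fun j _ => ?_)
      have h2 : (s⁻¹ • y) j ≤ 1 := by
        rw [← hx'.2]
        exact Finset.single_le_sum (f := s⁻¹ • y) (fun k _ => hx'.1 k) (Finset.mem_univ j)
      exact mul_le_of_le_one_right (hA.nonneg i j) h2
    have := hmax (a := (s⁻¹ • y, t + ε)) ⟨hle', hx', by linarith [ht.1], hT⟩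
    simp only [Set.mem_ofPred_eq] at this
    linarith
  refine ⟨t, x, fun i => ?_, heq⟩
  have hpow : ∀ k, A ^ k *ᵥ x = t ^ k • x := by
    intro k
    induction k with
    | zero => simp
    | succ k ih => rw [pow_succ, ← mulVec_mulVec, heq, mulVec_smul, ih, smul_smul, pow_succ']
  have hBeq : B *ᵥ x = (∑ k ∈ Finset.range N, t ^ k) • x := by
    rw [hB, sum_mulVec, Finset.sum_smul]
    exact Finset.sum_congr rfl fun k _ => hpow k
  have h1 := hBx i
  rw [hBeq] at h1
  refine lt_of_le_of_ne (hx.1 i) fun h => ?_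
  simp [← h] at h1

/-- A Perron triple of `A`: a positive number `lam` with positive left and right eigenvectors `p`
and `r`, normalized by `p ⬝ᵥ r = 1`. -/
structure IsPerronTriple (A : Matrix ι ι ℝ) (lam : ℝ) (p r : ι → ℝ) : Prop where
  pos : 0 < lam
  left_pos : ∀ i, 0 < p i
  right_pos : ∀ i, 0 < r i
  left_eq : p ᵥ* A = lam • p
  right_eq : A *ᵥ r = lam • r
  dot_eq : p ⬝ᵥ r = 1

lemma IsIrreducible.exists_isPerronTriple [Nonempty ι] (hA : A.IsIrreducible) :
    ∃ lam p r, IsPerronTriple A lam p r := by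
  classical
  obtain ⟨t, r, hr, hAr⟩ := hA.exists_mulVec_eq_smul
  obtain ⟨s, p, hp, hAp⟩ := hA.transpose.exists_mulVec_eq_smul
  rw [mulVec_transpose] at hAp
  have hpr : 0 < p ⬝ᵥ r := Finset.sum_pos (fun i _ => mul_pos (hp i) (hr i)) Finset.univ_nonempty
  have hst : s = t := by
    have h := dotProduct_mulVec p A r
    rw [hAr, hAp, dotProduct_smul, smul_dotProduct, smul_eq_mul, smul_eq_mul] at h
    exact (mul_right_cancel₀ hpr.ne' h).symm
  subst hst
  have hpos : 0 < s := by
    obtain ⟨i⟩ := ‹Nonempty ι›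
    have h0 : 0 ≤ s := by
      have h1 := congrFun hAr i
      simp only [mulVec, dotProduct, Pi.smul_apply, smul_eq_mul] at h1
      have h2 : 0 ≤ s * r i := h1 ▸ Finset.sum_nonneg fun j _ => mul_nonneg (hA.nonneg i j) (hr j).le
      exact nonneg_of_mul_nonneg_left h2 (hr i)
    refine lt_of_le_of_ne h0 fun h => ?_
    -- If the eigenvalue vanished, then so would `A` and its powers.
    have hzero : A = 0 := by
      ext a b
      have h1 := congrFun hAr a
      simp only [mulVec, dotProduct, Pi.smul_apply, smul_eq_mul, ← h, zero_mul] at h1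
      have h2 := (Finset.sum_eq_zero_iff_of_nonneg
        fun j _ => mul_nonneg (hA.nonneg a j) (hr j).le).1 h1 b (Finset.mem_univ b)
      exact (mul_eq_zero.1 h2).resolve_right (hr b).ne'
    obtain ⟨k, hk, hk'⟩ := (isIrreducible_iff_exists_pow_pos hA.nonneg).1 hA i i
    rw [hzero, zero_pow hk.ne'] at hk'
    simp at hk'
  refine ⟨s, (p ⬝ᵥ r)⁻¹ • p, r, hpos, fun i => mul_pos (inv_pos.2 hpr) (hp i), hr, ?_, hAr, ?_⟩
  · rw [smul_vecMul, hAp, smul_comm]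
  · rw [smul_dotProduct, smul_eq_mul, inv_mul_cancel₀ hpr.ne']

section Triple

variable {lam : ℝ} {p r : ι → ℝ}

lemma IsPerronTriple.sum_left (h : IsPerronTriple A lam p r) (j : ι) :
    ∑ i, p i * A i j = lam * p j := by
  simpa [vecMul, dotProduct] using congrFun h.left_eq j

lemma IsPerronTriple.sum_right (h : IsPerronTriple A lam p r) (i : ι) :
    ∑ j, A i j * r j = lam * r i := by
  simpa [mulVec, dotProduct] using congrFun h.right_eq i

lemma IsPerronTriple.nonempty (h : IsPerronTriple A lam p r) : Nonempty ι := by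
  by_contra hne
  rw [not_nonempty_iff] at hne
  simpa using h.dot_eq

lemma mem_spectrum_iff_exists_mulVec [DecidableEq ι] {B : Matrix ι ι ℂ} {z : ℂ} :
    z ∈ spectrum ℂ B ↔ ∃ v, v ≠ 0 ∧ B *ᵥ v = z • v := by
  rw [← Matrix.spectrum_toLin', ← Module.End.hasEigenvalue_iff_mem_spectrum]
  constructor
  · intro h
    obtain ⟨v, hv⟩ := h.exists_hasEigenvector
    exact ⟨v, hv.2, by simpa using hv.apply_eq_smul⟩
  · rintro ⟨v, hv, h⟩
    exact Module.End.hasEigenvalue_of_hasEigenvector (x := v)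
      ⟨Module.End.mem_eigenspace_iff.2 (by simpa using h), hv⟩

/-- Every complex eigenvalue `z` satisfies `|z| ≤ lam`: pair the inequality `|z| |v| ≤ A |v|` with
the positive left eigenvector. -/
lemma IsPerronTriple.norm_le_of_mem_spectrum [DecidableEq ι] (h : IsPerronTriple A lam p r)
    (hA : ∀ i j, 0 ≤ A i j) {z : ℂ} (hz : z ∈ spectrum ℂ (A.map Complex.ofReal)) : ‖z‖ ≤ lam := by
  obtain ⟨v, hv, hvz⟩ := mem_spectrum_iff_exists_mulVec.1 hz
  have h1 : ∀ i, ‖z‖ * ‖v i‖ ≤ ∑ j, A i j * ‖v j‖ := fun i => by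
    rw [← norm_mul, ← smul_eq_mul, ← Pi.smul_apply, ← hvz]
    refine (norm_sum_le _ _).trans (Finset.sum_le_sum fun j _ => ?_)
    simp [abs_of_nonneg (hA i j)]
  have h2 : ‖z‖ * ∑ i, p i * ‖v i‖ ≤ lam * ∑ i, p i * ‖v i‖ := by
    calc ‖z‖ * ∑ i, p i * ‖v i‖ = ∑ i, p i * (‖z‖ * ‖v i‖) := by
          rw [Finset.mul_sum]; exact Finset.sum_congr rfl fun i _ => by ring
      _ ≤ ∑ i, p i * ∑ j, A i j * ‖v j‖ :=
          Finset.sum_le_sum fun i _ => mul_le_mul_of_nonneg_left (h1 i) (h.left_pos i).le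
      _ = ∑ j, (∑ i, p i * A i j) * ‖v j‖ := by
          simp_rw [Finset.mul_sum, Finset.sum_mul]
          rw [Finset.sum_comm]
          exact Finset.sum_congr rfl fun i _ => Finset.sum_congr rfl fun j _ => by ring
      _ = lam * ∑ i, p i * ‖v i‖ := by
          rw [Finset.mul_sum]
          exact Finset.sum_congr rfl fun j _ => by rw [h.sum_left j]; ring
  obtain ⟨j, hj⟩ := Function.ne_iff.1 hv
  refine le_of_mul_le_mul_right h2 (Finset.sum_pos'
    (fun i _ => mul_nonneg (h.left_pos i).le (norm_nonneg _)) ⟨j, Finset.mem_univ j, ?_⟩)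
  exact mul_pos (h.left_pos j) (norm_pos_iff.2 hj)

lemma IsPerronTriple.mem_spectrum [DecidableEq ι] (h : IsPerronTriple A lam p r) :
    (lam : ℂ) ∈ spectrum ℂ (A.map Complex.ofReal) := by
  refine mem_spectrum_iff_exists_mulVec.2 ⟨fun i => (r i : ℂ), ?_, ?_⟩
  · obtain ⟨i⟩ := h.nonempty
    intro h0
    have := congrFun h0 i
    exact (h.right_pos i).ne' (by simpa using this)
  · ext i
    simpa [mulVec, dotProduct] using congrArg (Complex.ofReal) (h.sum_right i)

/-- Expansion of the Dirichlet form with the weights `p i * A i j * r j`, whose `i`-th row sum and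
`i`-th column sum are both `lam * p i * r i`. -/
lemma IsPerronTriple.dirichlet_eq (h : IsPerronTriple A lam p r) (f : ι → ℝ) :
    ∑ i, ∑ j, p i * A i j * r j * (f i - f j) ^ 2 =
      2 * (lam * ∑ i, p i * r i * f i ^ 2 - ∑ i, ∑ j, p i * A i j * r j * (f i * f j)) := by
  have h1 : ∑ i, ∑ j, p i * A i j * r j * f i ^ 2 = lam * ∑ i, p i * r i * f i ^ 2 := by
    rw [Finset.mul_sum]
    refine Finset.sum_congr rfl fun i _ => ?_
    calc ∑ j, p i * A i j * r j * f i ^ 2 = p i * f i ^ 2 * ∑ j, A i j * r j := by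
          rw [Finset.mul_sum]; exact Finset.sum_congr rfl fun j _ => by ring
      _ = lam * (p i * r i * f i ^ 2) := by rw [h.sum_right i]; ring
  have h2 : ∑ i, ∑ j, p i * A i j * r j * f j ^ 2 = lam * ∑ i, p i * r i * f i ^ 2 := by
    rw [Finset.sum_comm, Finset.mul_sum]
    refine Finset.sum_congr rfl fun j _ => ?_
    calc ∑ i, p i * A i j * r j * f j ^ 2 = r j * f j ^ 2 * ∑ i, p i * A i j := by
          rw [Finset.mul_sum]; exact Finset.sum_congr rfl fun j _ => by ring
      _ = lam * (p j * r j * f j ^ 2) := by rw [h.sum_left j]; ring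
  have h3 : ∑ i, ∑ j, p i * A i j * r j * (f i - f j) ^ 2 =
      ∑ i, ∑ j, p i * A i j * r j * f i ^ 2 + ∑ i, ∑ j, p i * A i j * r j * f j ^ 2 -
        2 * ∑ i, ∑ j, p i * A i j * r j * (f i * f j) := by
    simp only [Finset.mul_sum, ← Finset.sum_add_distrib, ← Finset.sum_sub_distrib]
    exact Finset.sum_congr rfl fun i _ => Finset.sum_congr rfl fun j _ => by ring
  rw [h3, h1, h2]
  ring

/-- By irreducibility, only constants have vanishing Dirichlet form. -/
lemma IsPerronTriple.eq_of_dirichlet_eq_zero (h : IsPerronTriple A lam p r)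
    (hA : A.IsIrreducible) {f : ι → ℝ}
    (hf : ∑ i, ∑ j, p i * A i j * r j * (f i - f j) ^ 2 = 0) (i j : ι) : f i = f j := by
  classical
  have hnn : ∀ i j, 0 ≤ p i * A i j * r j * (f i - f j) ^ 2 := fun i j =>
    mul_nonneg (mul_nonneg (mul_nonneg (h.left_pos i).le (hA.nonneg i j)) (h.right_pos j).le)
      (sq_nonneg _)
  have hedge : ∀ i j, 0 < A i j → f i = f j := fun i j hij => by
    have h1 := (Finset.sum_eq_zero_iff_of_nonneg
      fun i _ => Finset.sum_nonneg fun j _ => hnn i j).1 hf i (Finset.mem_univ i)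
    have h2 := (Finset.sum_eq_zero_iff_of_nonneg fun j _ => hnn i j).1 h1 j (Finset.mem_univ j)
    have h3 : p i * A i j * r j ≠ 0 :=
      (mul_pos (mul_pos (h.left_pos i) hij) (h.right_pos j)).ne'
    have h4 := (mul_eq_zero.1 h2).resolve_left h3
    exact sub_eq_zero.1 (pow_eq_zero_iff two_ne_zero |>.1 h4)
  have hpow : ∀ k : ℕ, ∀ i j, 0 < (A ^ k) i j → f i = f j := by
    intro k
    induction k with
    | zero =>
      intro i j hij
      by_cases hij' : i = j
      · rw [hij']
      · simp [hij'] at hij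
    | succ k ih =>
      intro i j hij
      rw [pow_succ, mul_apply] at hij
      obtain ⟨l, _, hl⟩ := Finset.exists_lt_of_sum_lt (f := fun _ => (0 : ℝ)) (by simpa using hij)
      have h1 := pow_apply_nonneg hA.nonneg k i l
      have h2 : 0 < (A ^ k) i l := pos_of_mul_pos_left hl (hA.nonneg l j)
      exact (ih i l h2).trans (hedge l j (pos_of_mul_pos_right hl h1))
  obtain ⟨k, _, hk⟩ := (isIrreducible_iff_exists_pow_pos hA.nonneg).1 hA i j
  exact hpow k i j hk

/-- The left eigenspace of `lam` is one-dimensional: for an eigenvector `v`, the Dirichlet form of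
`v / p` vanishes. -/
lemma IsPerronTriple.exists_eq_smul (h : IsPerronTriple A lam p r) (hA : A.IsIrreducible)
    {v : ι → ℝ} (hv : v ᵥ* A = lam • v) : ∃ c : ℝ, v = c • p := by
  obtain ⟨i₀⟩ := h.nonempty
  have hf := h.eq_of_dirichlet_eq_zero hA (f := fun i => v i / p i) (by
    rw [h.dirichlet_eq]
    have : ∑ i, ∑ j, p i * A i j * r j * (v i / p i * (v j / p j)) =
        lam * ∑ j, p j * r j * (v j / p j) ^ 2 := by
      rw [Finset.sum_comm, Finset.mul_sum]
      refine Finset.sum_congr rfl fun j _ => ?_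
      have hj : ∑ i, v i * A i j = lam * v j := by
        simpa [vecMul, dotProduct] using congrFun hv j
      have hpj := (h.left_pos j).ne'
      calc ∑ i, p i * A i j * r j * (v i / p i * (v j / p j)) =
            r j * (v j / p j) * ∑ i, v i * A i j := by
            rw [Finset.mul_sum]
            refine Finset.sum_congr rfl fun i _ => ?_
            have := (h.left_pos i).ne'
            field_simp
        _ = lam * (p j * r j * (v j / p j) ^ 2) := by rw [hj]; field_simp
    rw [this]; ring)
  refine ⟨v i₀ / p i₀, funext fun i => ?_⟩
  have h1 := hf i i₀
  rw [Pi.smul_apply, smul_eq_mul, ← h1, div_mul_cancel₀ _ (h.left_pos i).ne']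

/-- The spectral gap: on the vectors `w` with `w ⬝ᵥ r = 0`, the form `⟨w (A - lam), w⟩` for the
inner product with weights `r / p` is negative definite. -/
lemma IsPerronTriple.exists_gap (h : IsPerronTriple A lam p r) (hA : A.IsIrreducible) :
    ∃ δ > 0, ∀ w : ι → ℝ, w ⬝ᵥ r = 0 →
      ∑ j, r j / p j * (w j * ((w ᵥ* A) j - lam * w j)) ≤ - δ * ∑ j, r j / p j * w j ^ 2 := by
  set G : (ι → ℝ) → ℝ := fun w => ∑ i, ∑ j, p i * A i j * r j * (w i / p i - w j / p j) ^ 2 with hG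
  set V : (ι → ℝ) → ℝ := fun w => ∑ j, r j / p j * w j ^ 2 with hV
  have hGV : ∀ w, ∑ j, r j / p j * (w j * ((w ᵥ* A) j - lam * w j)) = - (G w / 2) := fun w => by
    simp only [hG]
    rw [h.dirichlet_eq, mul_div_cancel_left₀ _ (two_ne_zero), neg_sub, Finset.sum_comm,
      Finset.mul_sum, ← Finset.sum_sub_distrib]
    refine Finset.sum_congr rfl fun j _ => ?_
    have hpj := (h.left_pos j).ne'
    have : ∑ i, p i * A i j * r j * (w i / p i * (w j / p j)) =
        r j * (w j / p j) * (w ᵥ* A) j := by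
      simp only [vecMul, dotProduct, Finset.mul_sum]
      refine Finset.sum_congr rfl fun i _ => ?_
      have := (h.left_pos i).ne'
      field_simp
    rw [this]
    field_simp
  have hGnn : ∀ w, 0 ≤ G w := fun w => Finset.sum_nonneg fun i _ => Finset.sum_nonneg fun j _ =>
    mul_nonneg (mul_nonneg (mul_nonneg (h.left_pos i).le (hA.nonneg i j)) (h.right_pos j).le)
      (sq_nonneg _)
  have hVnn : ∀ w, 0 ≤ V w := fun w => Finset.sum_nonneg fun i _ =>
    mul_nonneg (div_pos (h.right_pos i) (h.left_pos i)).le (sq_nonneg _)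
  have hGc : Continuous G := by fun_prop
  have hVc : Continuous V := by fun_prop
  have hG0 : ∀ w : ι → ℝ, w ⬝ᵥ r = 0 → G w = 0 → w = 0 := fun w hw hGw => by
    have hc := h.eq_of_dirichlet_eq_zero hA (f := fun i => w i / p i) hGw
    obtain ⟨i₀⟩ := h.nonempty
    have hw' : w = (w i₀ / p i₀) • p := funext fun i => by
      have := hc i i₀
      rw [Pi.smul_apply, smul_eq_mul, ← this, div_mul_cancel₀ _ (h.left_pos i).ne']
    rw [hw', smul_dotProduct, h.dot_eq, smul_eq_mul, mul_one] at hw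
    rw [hw', hw, zero_smul]
  set S : Set (ι → ℝ) := {w | w ⬝ᵥ r = 0} ∩ Metric.sphere 0 1 with hS
  have hScomp : IsCompact S := by
    refine (isCompact_sphere _ _).inter_left (isClosed_eq ?_ continuous_const)
    simp only [dotProduct]
    fun_prop
  -- It suffices to compare the two quadratic forms on the unit sphere.
  suffices hδ : ∃ δ > 0, ∀ w ∈ S, δ * V w ≤ G w / 2 by
    obtain ⟨δ, hδ, hle⟩ := hδ
    refine ⟨δ, hδ, fun w hw => ?_⟩
    rw [hGV]
    change -(G w / 2) ≤ -δ * V w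
    by_cases hw0 : w = 0
    · subst hw0
      simp [hG, hV]
    · have hn : ‖w‖ ≠ 0 := norm_ne_zero_iff.2 hw0
      have h1 := hle (‖w‖⁻¹ • w) ⟨by simp [smul_dotProduct, hw], by
        rw [mem_sphere_zero_iff_norm, norm_smul, norm_inv, norm_norm, inv_mul_cancel₀ hn]⟩
      have hGs : G (‖w‖⁻¹ • w) = (‖w‖⁻¹) ^ 2 * G w := by
        simp only [hG, Finset.mul_sum, Pi.smul_apply, smul_eq_mul]
        exact Finset.sum_congr rfl fun i _ => Finset.sum_congr rfl fun j _ => by ring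
      have hVs : V (‖w‖⁻¹ • w) = (‖w‖⁻¹) ^ 2 * V w := by
        simp only [hV, Finset.mul_sum, Pi.smul_apply, smul_eq_mul]
        exact Finset.sum_congr rfl fun i _ => by ring
      rw [hGs, hVs] at h1
      have hpos : 0 < (‖w‖⁻¹) ^ 2 := by positivity
      nlinarith
  rcases S.eq_empty_or_nonempty with hSe | hSne
  · exact ⟨1, one_pos, fun w hw => by simp [hSe] at hw⟩
  obtain ⟨w₀, hw₀, hmin⟩ := hScomp.exists_isMinOn hSne hGc.continuousOn
  obtain ⟨w₁, hw₁, hmax⟩ := hScomp.exists_isMaxOn hSne hVc.continuousOn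
  have hg : 0 < G w₀ := lt_of_le_of_ne (hGnn w₀) fun h0 => by
    have := hG0 w₀ hw₀.1 h0.symm
    have h1 := hw₀.2
    simp [this] at h1
  refine ⟨G w₀ / 2 / (V w₁ + 1), by have := hVnn w₁; positivity, fun w hw => ?_⟩
  have h1 : G w₀ ≤ G w := hmin hw
  have h2 : V w ≤ V w₁ := hmax hw
  have h3 : 0 < V w₁ + 1 := by linarith [hVnn w₁]
  rw [div_mul_eq_mul_div, div_le_iff₀ h3]
  nlinarith [hVnn w]

end Triple

end Perron

end Matrix

namespace RandomUrn

variable {K : ℕ} {A : Matrix (Fin K) (Fin K) ℝ} {lam : ℝ} {p r : Fin K → ℝ}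

lemma isDominantEigenvalue_of_isPerronTriple (h : A.IsPerronTriple lam p r)
    (hA : A.IsIrreducible) : IsDominantEigenvalue A lam := by
  refine ⟨h.mem_spectrum, fun z hz hne => ?_⟩
  have h1 := h.norm_le_of_mem_spectrum hA.nonneg hz
  refine lt_of_le_of_ne ((Complex.re_le_norm z).trans h1) fun hre => hne ?_
  -- `re z = lam` and `|z| ≤ lam` force the imaginary part to vanish.
  have h2 : z.re ^ 2 + z.im ^ 2 ≤ lam ^ 2 := by
    have h3 := pow_le_pow_left₀ (norm_nonneg z) h1 2
    linarith [Complex.sq_norm_sub_sq_re z]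
  have h3 : z.im = 0 := by rw [hre] at h2; nlinarith
  exact Complex.ext (by simpa using hre) (by simpa using h3)

lemma dominantEigenvalue_eq (h : A.IsPerronTriple lam p r) (hA : A.IsIrreducible) :
    dominantEigenvalue A = lam := by
  have hdom := isDominantEigenvalue_of_isPerronTriple h hA
  refine IsGreatest.csSup_eq ⟨⟨lam, hdom.1, Complex.ofReal_re lam⟩, ?_⟩
  rintro _ ⟨z, hz, rfl⟩
  by_cases hzl : z = lam
  · simp [hzl]
  · exact (hdom.2 z hz hzl).le

lemma isPerronVector_iff (h : A.IsPerronTriple lam p r) (hA : A.IsIrreducible) (v : Fin K → ℝ) :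
    IsPerronVector A v ↔ v = (∑ i, p i)⁻¹ • p := by
  have := h.nonempty
  have hs : 0 < ∑ i, p i := Finset.sum_pos (fun i _ => h.left_pos i) Finset.univ_nonempty
  rw [IsPerronVector, dominantEigenvalue_eq h hA]
  constructor
  · rintro ⟨h1, -, h3⟩
    obtain ⟨c, rfl⟩ := h.exists_eq_smul hA h1
    simp only [Pi.smul_apply, smul_eq_mul, ← Finset.mul_sum] at h3
    rw [eq_inv_of_mul_eq_one_left h3]
  · rintro rfl
    refine ⟨?_, fun i => mul_pos (inv_pos.2 hs) (h.left_pos i), ?_⟩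
    · rw [Matrix.smul_vecMul, h.left_eq, smul_comm]
    · simp only [Pi.smul_apply, smul_eq_mul, ← Finset.mul_sum]
      exact inv_mul_cancel₀ hs.ne'

lemma perronVector_eq (h : A.IsPerronTriple lam p r) (hA : A.IsIrreducible) :
    perronVector A = (∑ i, p i)⁻¹ • p := by
  have hex : ∃ v, IsPerronVector A v := ⟨_, (isPerronVector_iff h hA _).2 rfl⟩
  rw [perronVector, dif_pos hex]
  exact (isPerronVector_iff h hA _).1 hex.choose_spec

end RandomUrn

/-! ### A stochastic approximation recursion -/

/-- A perturbed contraction with non-summable steps `γ n ≥ a / n` and vanishing perturbations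
converges to zero. -/
lemma tendsto_zero_of_recursion_le {V γ θ : ℕ → ℝ} {c a : ℝ} (hc : 0 < c) (ha : 0 < a)
    (hV : ∀ n, 0 ≤ V n) (hγ : Tendsto γ atTop (𝓝 0)) (hγa : ∀ᶠ n : ℕ in atTop, a / n ≤ γ n)
    (hθ : Tendsto θ atTop (𝓝 0))
    (hrec : ∀ᶠ n in atTop, V (n + 1) ≤ (1 - c * γ n) * V n + γ n * θ n) :
    Tendsto V atTop (𝓝 0) := by
  refine tendsto_order.2 ⟨fun b hb => Eventually.of_forall fun n => hb.trans_le (hV n),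
    fun ε hε => ?_⟩
  have h1 : ∀ᶠ n in atTop, θ n < c * (ε / 2) := hθ.eventually_lt_const (by positivity)
  have h2 : ∀ᶠ n in atTop, γ n < 1 / c := hγ.eventually_lt_const (by positivity)
  obtain ⟨N, hN⟩ := eventually_atTop.1 (h1.and (h2.and (hγa.and hrec)))
  have hγ0 : ∀ n, N ≤ n → 0 ≤ γ n := fun n hn => le_trans (by positivity) (hN n hn).2.2.1
  have hγ1 : ∀ n, N ≤ n → 0 ≤ 1 - c * γ n := fun n hn => by
    have := ((lt_div_iff₀ hc).1 (hN n hn).2.1)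
    linarith
  -- `V - ε / 2` is dominated by a product of contraction factors.
  have hU : ∀ m, V (N + m) - ε / 2 ≤
      Real.exp (-(c * ∑ k ∈ Finset.range m, a / ((N + k : ℕ) : ℝ))) * V N := by
    intro m
    induction m with
    | zero => simp; linarith
    | succ m ih =>
      obtain ⟨g1, -, g3, g4⟩ := hN (N + m) (Nat.le_add_right _ _)
      have g0 := hγ0 (N + m) (Nat.le_add_right _ _)
      have g5 := hγ1 (N + m) (Nat.le_add_right _ _)
      have g6 : V (N + m + 1) - ε / 2 ≤ (1 - c * γ (N + m)) * (V (N + m) - ε / 2) := by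
        nlinarith [mul_le_mul_of_nonneg_left g1.le g0]
      have g7 : 1 - c * γ (N + m) ≤ Real.exp (-(c * (a / ((N + m : ℕ) : ℝ)))) := by
        have h8 := mul_le_mul_of_nonneg_left g3 hc.le
        have h9 := Real.add_one_le_exp (-(c * (a / ((N + m : ℕ) : ℝ))))
        linarith
      refine g6.trans ((mul_le_mul_of_nonneg_left ih g5).trans ?_)
      rw [Finset.sum_range_succ, mul_add, neg_add_rev, Real.exp_add, mul_assoc]
      exact mul_le_mul_of_nonneg_right g7 (mul_nonneg (Real.exp_pos _).le (hV N))
  have hdiv : Tendsto (fun m => ∑ k ∈ Finset.range m, a / ((N + k : ℕ) : ℝ)) atTop atTop := by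
    refine (not_summable_iff_tendsto_nat_atTop_of_nonneg fun k => by positivity).1 fun hs => ?_
    have hs' : Summable fun k : ℕ => (1 / ((k + N : ℕ) : ℝ)) := by
      refine (hs.mul_left a⁻¹).congr fun k => ?_
      rw [add_comm N k]
      field_simp
    exact Real.not_summable_one_div_natCast
      ((summable_nat_add_iff (f := fun k : ℕ => (1 / (k : ℝ))) N).1 hs')
  have hexp : Tendsto (fun m =>
      Real.exp (-(c * ∑ k ∈ Finset.range m, a / ((N + k : ℕ) : ℝ))) * V N) atTop (𝓝 0) := by
    have := (Real.tendsto_exp_neg_atTop_nhds_zero.comp (hdiv.const_mul_atTop hc)).mul_const (V N)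
    simpa using this
  obtain ⟨m₀, hm₀⟩ := eventually_atTop.1 (hexp.eventually_lt_const (half_pos hε))
  refine eventually_atTop.2 ⟨N + m₀, fun n hn => ?_⟩
  obtain ⟨m, rfl⟩ := Nat.exists_eq_add_of_le (show N ≤ n by omega)
  linarith [hU m, hm₀ m (by omega)]

section Recursion

variable {ι : Type*} [Fintype ι] {A : Matrix ι ι ℝ} {lam : ℝ} {p r : ι → ℝ}
  {y e : ℕ → ι → ℝ} {S : ℕ → ℝ}

/-- The self-normalized recursion `S n • y n = (∑ k < n, y k) A + e n` with `e n = o(n)`: the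
averages of the probability vectors `y k` converge to the Perron vector. With
`M n = (∑ k < n, y k) ⬝ᵥ r`, the deviation `w n = (M n)⁻¹ • ∑ k < n, y k - p` is orthogonal to `r`
and obeys `w (n + 1) = w n + γ n • (w n (A - lam) + η n)` where `γ n` is of order `1 / n` and
`η n → 0`; the quadratic form of `Matrix.IsPerronTriple.exists_gap` is a Lyapunov function. -/
theorem Matrix.IsPerronTriple.tendsto_average (h : A.IsPerronTriple lam p r)
    (hA : A.IsIrreducible) (hy0 : ∀ n i, 0 ≤ y n i) (hy1 : ∀ n, ∑ i, y n i = 1)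
    (hS : ∀ n, 0 < S n)
    (hrec : ∀ n, S n • y n = (∑ k ∈ Finset.range n, y k) ᵥ* A + e n)
    (he : ∀ i, Tendsto (fun n : ℕ => e n i / n) atTop (𝓝 0)) (i : ι) :
    Tendsto (fun n : ℕ => (∑ k ∈ Finset.range n, y k) i / n) atTop (𝓝 ((∑ i, p i)⁻¹ * p i)) := by
  have hne := h.nonempty
  obtain ⟨δ, hδ, hgap⟩ := h.exists_gap hA
  obtain ⟨i₀, hi₀⟩ := Finite.exists_min r
  obtain ⟨i₁, hi₁⟩ := Finite.exists_max r
  set a := r i₀ with ha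
  set b := r i₁ with hb
  have ha0 : 0 < a := h.right_pos i₀
  have hb0 : 0 < b := h.right_pos i₁
  have hlam := h.pos
  -- Pairing a nonnegative vector with `r` compares it with the sum of its coordinates.
  have hlow : ∀ v : ι → ℝ, (∀ i, 0 ≤ v i) → a * ∑ i, v i ≤ v ⬝ᵥ r := fun v hv => by
    rw [Finset.mul_sum]
    exact Finset.sum_le_sum fun i _ => by nlinarith [hi₀ i, hv i]
  have hupp : ∀ v : ι → ℝ, (∀ i, 0 ≤ v i) → v ⬝ᵥ r ≤ b * ∑ i, v i := fun v hv => by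
    rw [Finset.mul_sum]
    exact Finset.sum_le_sum fun i _ => by nlinarith [hi₁ i, hv i]
  set Y : ℕ → ι → ℝ := fun n => ∑ k ∈ Finset.range n, y k with hY
  have hYs : ∀ n, Y (n + 1) = Y n + y n := fun n => Finset.sum_range_succ _ _
  have hY0 : ∀ n i, 0 ≤ Y n i := fun n i => by
    simp only [hY, Finset.sum_apply]
    exact Finset.sum_nonneg fun k _ => hy0 k i
  have hYsum : ∀ n, ∑ i, Y n i = n := fun n => by
    simp only [hY, Finset.sum_apply]
    rw [Finset.sum_comm]
    simp [hy1]
  set M : ℕ → ℝ := fun n => Y n ⬝ᵥ r with hM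
  have hMlow : ∀ n, a * n ≤ M n := fun n => by rw [← hYsum n]; exact hlow _ (hY0 n)
  have hMupp : ∀ n, M n ≤ b * n := fun n => by rw [← hYsum n]; exact hupp _ (hY0 n)
  have hMs : ∀ n, M (n + 1) = M n + y n ⬝ᵥ r := fun n => by
    simp only [hM]; rw [hYs, add_dotProduct]
  have hMpos : ∀ n, 0 < n → 0 < M n := fun n hn => by
    have : (0 : ℝ) < n := by exact_mod_cast hn
    exact lt_of_lt_of_le (by positivity) (hMlow n)
  set u : ℕ → ι → ℝ := fun n => (M n)⁻¹ • Y n with hu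
  set w : ℕ → ι → ℝ := fun n => u n - p with hw
  set γ : ℕ → ℝ := fun n => M n / (S n * M (n + 1)) with hγ
  set η : ℕ → ι → ℝ := fun n => (M n)⁻¹ • (e n - (e n ⬝ᵥ r) • u n) with hη
  have hu0 : ∀ n i, 0 ≤ u n i := fun n i => by
    have : 0 ≤ M n := le_trans (by positivity) (hMlow n)
    exact mul_nonneg (inv_nonneg.2 this) (hY0 n i)
  have hub : ∀ n i, u n i ≤ 1 / a := fun n i => by
    rcases Nat.eq_zero_or_pos n with rfl | hn
    · simp [hu, hY]
      positivity
    · have h1 := hMpos n hn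
      simp only [hu, Pi.smul_apply, smul_eq_mul]
      rw [inv_mul_le_iff₀ h1, mul_one_div, le_div_iff₀ ha0]
      have h2 : Y n i * r i ≤ M n :=
        Finset.single_le_sum (f := fun i => Y n i * r i)
          (fun j _ => mul_nonneg (hY0 n j) (h.right_pos j).le) (Finset.mem_univ i)
      nlinarith [hi₀ i, hY0 n i]
  have hwb : ∀ n i, |w n i| ≤ 1 / a + p i := fun n i => by
    have h1 := hu0 n i
    have h2 := hub n i
    have h3 := (h.left_pos i).le
    have h4 : 0 ≤ 1 / a := by positivity
    simp only [hw, Pi.sub_apply]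
    rw [abs_le]
    constructor <;> linarith
  have her : Tendsto (fun n : ℕ => (e n ⬝ᵥ r) / n) atTop (𝓝 0) := by
    have h1 := tendsto_finsetSum Finset.univ fun i _ => (he i).mul_const (r i)
    simp only [zero_mul, Finset.sum_const_zero] at h1
    refine h1.congr fun n => ?_
    rw [dotProduct, Finset.sum_div]
    exact Finset.sum_congr rfl fun i _ => by ring
  have hSr : ∀ n, S n * (y n ⬝ᵥ r) = lam * M n + e n ⬝ᵥ r := fun n => by
    have h1 := congrArg (fun v => v ⬝ᵥ r) (hrec n)
    simp only [smul_dotProduct, add_dotProduct, smul_eq_mul] at h1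
    rw [← Matrix.dotProduct_mulVec, h.right_eq, dotProduct_smul, smul_eq_mul] at h1
    exact h1
  have hyr : ∀ n, a ≤ y n ⬝ᵥ r ∧ y n ⬝ᵥ r ≤ b := fun n => by
    have h1 := hlow _ (hy0 n)
    have h2 := hupp _ (hy0 n)
    rw [hy1, mul_one] at h1 h2
    exact ⟨h1, h2⟩
  -- `S n` is of order `n`.
  have hSlow : ∀ᶠ n : ℕ in atTop, lam * a / (2 * b) * n ≤ S n := by
    filter_upwards [her.eventually_const_lt (show -(lam * a / 2) < 0 by
      have : 0 < lam * a / 2 := by positivity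
      linarith), eventually_gt_atTop 0] with n hn hn0
    have hn0' : (0 : ℝ) < n := by exact_mod_cast hn0
    rw [lt_div_iff₀ hn0'] at hn
    have h1 := hSr n
    have h2 := mul_le_mul_of_nonneg_left (hyr n).2 (hS n).le
    have h3 := mul_le_mul_of_nonneg_left (hMlow n) hlam.le
    have h4 : lam * a / 2 * n ≤ S n * b := by linarith
    rw [div_mul_eq_mul_div, div_le_iff₀ (by positivity)]
    linarith
  have hSupp : ∀ᶠ n : ℕ in atTop, S n ≤ (lam * b + 1) / a * n := by
    filter_upwards [her.eventually_lt_const one_pos, eventually_gt_atTop 0] with n hn hn0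
    have hn0' : (0 : ℝ) < n := by exact_mod_cast hn0
    rw [div_lt_iff₀ hn0'] at hn
    have h1 := hSr n
    have h2 := mul_le_mul_of_nonneg_left (hyr n).1 (hS n).le
    have h3 := mul_le_mul_of_nonneg_left (hMupp n) hlam.le
    rw [div_mul_eq_mul_div, le_div_iff₀ ha0]
    linarith
  have hMle : ∀ n, M n ≤ M (n + 1) := fun n => by rw [hMs]; linarith [(hyr n).1]
  have hγ0 : Tendsto γ atTop (𝓝 0) := by
    have hlim : Tendsto (fun n : ℕ => (lam * a / (2 * b))⁻¹ * (1 / (n : ℝ))) atTop (𝓝 0) := by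
      simpa using tendsto_one_div_atTop_nhds_zero_nat.const_mul (lam * a / (2 * b))⁻¹
    refine squeeze_zero' ?_ ?_ hlim
    · filter_upwards [eventually_gt_atTop 0] with n hn
      have h1 := hMpos n hn
      have h2 := hMpos (n + 1) n.succ_pos
      have h3 := hS n
      positivity
    · filter_upwards [hSlow, eventually_gt_atTop 0] with n hn hn0
      have h1 := hMpos n hn0
      have h2 := hMpos (n + 1) n.succ_pos
      have h3 := hS n
      have hn0' : (0 : ℝ) < n := by exact_mod_cast hn0
      have h4 : γ n ≤ 1 / S n := by
        simp only [hγ]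
        rw [div_le_div_iff₀ (by positivity) h3]
        nlinarith [mul_le_mul_of_nonneg_left (hMle n) h3.le]
      refine h4.trans ?_
      rw [one_div, one_div, ← mul_inv]
      exact inv_anti₀ (by positivity) hn
  have hγa : ∀ᶠ n : ℕ in atTop, a / (2 * b) / ((lam * b + 1) / a) / n ≤ γ n := by
    filter_upwards [hSupp, eventually_gt_atTop 0] with n hn hn0
    have h1 := hMpos n hn0
    have h2 := hMpos (n + 1) n.succ_pos
    have h3 := hS n
    have hn0' : (1 : ℝ) ≤ n := by exact_mod_cast hn0
    have h4 : a / (2 * b) ≤ M n / M (n + 1) := by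
      rw [div_le_div_iff₀ (by positivity) h2]
      have h5 := hMupp (n + 1)
      push_cast at h5
      nlinarith [hMlow n, mul_le_mul_of_nonneg_left h5 ha0.le, mul_pos ha0 hb0]
    have h5 : γ n = M n / M (n + 1) / S n := by simp only [hγ]; field_simp
    rw [h5, div_div]
    exact div_le_div₀ (by positivity) h4 h3 hn
  have hη0 : ∀ i, Tendsto (fun n => η n i) atTop (𝓝 0) := fun i => by
    have h1 : Tendsto (fun n : ℕ => |e n i / n| + |(e n ⬝ᵥ r) / n| * (1 / a)) atTop (𝓝 0) := by
      simpa using (he i).abs.add (her.abs.mul_const (1 / a))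
    have h2 : Tendsto (fun n : ℕ => a⁻¹ * (|e n i / n| + |(e n ⬝ᵥ r) / n| * (1 / a)))
        atTop (𝓝 0) := by simpa using h1.const_mul a⁻¹
    refine squeeze_zero_norm' ?_ h2
    filter_upwards [eventually_gt_atTop 0] with n hn
    have hn0' : (0 : ℝ) < n := by exact_mod_cast hn
    have hm := hMpos n hn
    have h3 : |e n i - (e n ⬝ᵥ r) * u n i| ≤ |e n i| + |e n ⬝ᵥ r| * (1 / a) := by
      refine (abs_sub _ _).trans (add_le_add le_rfl ?_)
      rw [abs_mul, abs_of_nonneg (hu0 n i)]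
      exact mul_le_mul_of_nonneg_left (hub n i) (abs_nonneg _)
    simp only [hη, Pi.smul_apply, Pi.sub_apply, smul_eq_mul, Real.norm_eq_abs]
    rw [abs_mul, abs_of_pos (inv_pos.2 hm), abs_div, abs_div, abs_of_pos hn0']
    have h4 : (M n)⁻¹ ≤ (a * n)⁻¹ := inv_anti₀ (by positivity) (hMlow n)
    calc (M n)⁻¹ * |e n i - e n ⬝ᵥ r * u n i|
        ≤ (a * n)⁻¹ * (|e n i| + |e n ⬝ᵥ r| * (1 / a)) :=
          mul_le_mul h4 h3 (abs_nonneg _) (by positivity)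
      _ = a⁻¹ * (|e n i| / n + |e n ⬝ᵥ r| / n * (1 / a)) := by field_simp
  have hwr : ∀ n, 0 < n → w n ⬝ᵥ r = 0 := fun n hn => by
    simp only [hw, hu]
    rw [sub_dotProduct, smul_dotProduct, h.dot_eq, smul_eq_mul, inv_mul_cancel₀ (hMpos n hn).ne',
      sub_self]
  set D : ℕ → ι → ℝ := fun n j => (w n ᵥ* A) j - lam * w n j with hD
  have hstep : ∀ n, 0 < n → ∀ j, w (n + 1) j = w n j + γ n * (D n j + η n j) := fun n hn j => by
    have h1 := (hMpos n hn).ne'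
    have h2 := (hMpos (n + 1) n.succ_pos).ne'
    have h3 := (hS n).ne'
    have h4 : S n * y n j = (Y n ᵥ* A) j + e n j := by
      simpa using congrFun (hrec n) j
    have h5 : (w n ᵥ* A) j = (M n)⁻¹ * (Y n ᵥ* A) j - lam * p j := by
      simp only [hw, hu]
      rw [Matrix.sub_vecMul, Matrix.smul_vecMul, h.left_eq]
      simp
    have h6 : y n j = ((Y n ᵥ* A) j + e n j) / S n := by rw [← h4]; field_simp
    have h7 : y n ⬝ᵥ r = (lam * M n + e n ⬝ᵥ r) / S n := by rw [← hSr]; field_simp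
    have h8 : u (n + 1) j = (M (n + 1))⁻¹ * (Y n j + y n j) := by simp [hu, hYs]
    have h9 : Y n j = M n * u n j := by simp only [hu, Pi.smul_apply, smul_eq_mul]; field_simp
    have h10 : w (n + 1) j - w n j = (y n j - u n j * (y n ⬝ᵥ r)) / M (n + 1) := by
      have : w (n + 1) j - w n j = u (n + 1) j - u n j := by simp [hw]
      rw [this, h8, h9, eq_div_iff h2, sub_mul, mul_comm (M (n + 1))⁻¹, inv_mul_cancel_right₀ h2,
        hMs n]
      ring
    have h11 : D n j = (M n)⁻¹ * (Y n ᵥ* A) j - lam * u n j := by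
      simp only [hD, h5]
      simp only [hw, Pi.sub_apply]
      ring
    have h12 : η n j = (M n)⁻¹ * (e n j - (e n ⬝ᵥ r) * u n j) := by simp [hη]
    rw [← sub_eq_iff_eq_add', h10, h11, h12, h6, h7]
    simp only [hγ]
    field_simp
    ring
  set c : ι → ℝ := fun j => r j / p j with hc
  have hc0 : ∀ j, 0 < c j := fun j => div_pos (h.right_pos j) (h.left_pos j)
  set V : ℕ → ℝ := fun n => ∑ j, c j * w n j ^ 2 with hV
  set θ : ℕ → ℝ := fun n =>
    ∑ j, c j * (2 * (w n j * η n j) + γ n * (D n j + η n j) ^ 2) with hθ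
  have hDb : ∀ j, ∃ C, ∀ n, |D n j| ≤ C := fun j => by
    refine ⟨∑ i, (1 / a + p i) * |A i j| + lam * (1 / a + p j), fun n => ?_⟩
    refine (abs_sub _ _).trans (add_le_add ?_ ?_)
    · refine (Finset.abs_sum_le_sum_abs _ _).trans (Finset.sum_le_sum fun i _ => ?_)
      rw [abs_mul]
      exact mul_le_mul_of_nonneg_right (hwb n i) (abs_nonneg _)
    · rw [abs_mul, abs_of_pos hlam]
      exact mul_le_mul_of_nonneg_left (hwb n j) hlam.le
  have hθ0 : Tendsto θ atTop (𝓝 0) := by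
    rw [show (0 : ℝ) = ∑ j : ι, c j * (2 * 0 + 0) by simp]
    refine tendsto_finsetSum _ fun j _ => (Tendsto.add (Tendsto.const_mul _ ?_) ?_).const_mul _
    · have h1 : Tendsto (fun n => (1 / a + p j) * |η n j|) atTop (𝓝 0) := by
        simpa using (hη0 j).abs.const_mul (1 / a + p j)
      refine squeeze_zero_norm (fun n => ?_) h1
      rw [Real.norm_eq_abs, abs_mul]
      exact mul_le_mul_of_nonneg_right (hwb n j) (abs_nonneg _)
    · obtain ⟨C, hC⟩ := hDb j
      have h1 : Tendsto (fun n => |γ n| * (C + |η n j|) ^ 2) atTop (𝓝 0) := by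
        simpa using hγ0.abs.mul (((hη0 j).abs.const_add C).pow 2)
      refine squeeze_zero_norm (fun n => ?_) h1
      rw [Real.norm_eq_abs, abs_mul, abs_pow]
      refine mul_le_mul_of_nonneg_left (pow_le_pow_left₀ (abs_nonneg _) ?_ 2) (abs_nonneg _)
      exact (abs_add_le _ _).trans (add_le_add (hC n) le_rfl)
  have hVrec : ∀ᶠ n in atTop, V (n + 1) ≤ (1 - 2 * δ * γ n) * V n + γ n * θ n := by
    filter_upwards [hγa, eventually_gt_atTop 0] with n hγn hn
    have hγn' : 0 ≤ γ n := le_trans (by positivity) hγn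
    have h1 : V (n + 1) = V n + 2 * γ n * (∑ j, c j * (w n j * D n j)) + γ n * θ n := by
      simp only [hV, hθ, Finset.mul_sum, ← Finset.sum_add_distrib]
      refine Finset.sum_congr rfl fun j _ => ?_
      rw [hstep n hn j]
      ring
    have h2 : ∑ j, c j * (w n j * D n j) ≤ -δ * V n := hgap (w n) (hwr n hn)
    nlinarith [mul_le_mul_of_nonneg_left h2 hγn']
  have hVlim : Tendsto V atTop (𝓝 0) :=
    tendsto_zero_of_recursion_le (by positivity) (by positivity)
      (fun n => Finset.sum_nonneg fun j _ => mul_nonneg (hc0 j).le (sq_nonneg _)) hγ0 hγa hθ0 hVrec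
  have hwlim : ∀ j, Tendsto (fun n => w n j) atTop (𝓝 0) := fun j => by
    have h1 : Tendsto (fun n => √((c j)⁻¹ * V n)) atTop (𝓝 0) := by
      simpa using (hVlim.const_mul (c j)⁻¹).sqrt
    refine squeeze_zero_norm (fun n => ?_) h1
    refine Real.le_sqrt_of_sq_le ?_
    rw [Real.norm_eq_abs, sq_abs, inv_mul_eq_div, le_div_iff₀ (hc0 j), mul_comm]
    exact Finset.single_le_sum (f := fun j => c j * w n j ^ 2)
      (fun j _ => mul_nonneg (hc0 j).le (sq_nonneg _)) (Finset.mem_univ j)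
  have hulim : ∀ j, Tendsto (fun n => u n j) atTop (𝓝 (p j)) := fun j => by
    have h1 := (hwlim j).add_const (p j)
    simpa [hw] using h1
  have hsum : Tendsto (fun n => ∑ j, u n j) atTop (𝓝 (∑ j, p j)) :=
    tendsto_finsetSum _ fun j _ => hulim j
  have hp : 0 < ∑ j, p j := Finset.sum_pos (fun j _ => h.left_pos j) Finset.univ_nonempty
  refine ((hsum.inv₀ hp.ne').mul (hulim i)).congr' ?_
  filter_upwards [eventually_gt_atTop 0] with n hn
  have h1 := (hMpos n hn).ne'
  have h2 : (n : ℝ) ≠ 0 := by exact_mod_cast hn.ne'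
  have h3 : ∑ j, u n j = (M n)⁻¹ * n := by
    rw [← hYsum n, Finset.mul_sum]
    rfl
  rw [h3]
  simp only [hu, Pi.smul_apply, smul_eq_mul]
  field_simp
  rfl

end Recursion

/-! ### A strong law for martingale differences -/

/-- Kronecker's lemma for the weights `n + 1`. -/
lemma tendsto_average_of_tendsto_sum_div {d : ℕ → ℝ} {l : ℝ}
    (h : Tendsto (fun n => ∑ k ∈ Finset.range n, d k / (k + 1)) atTop (𝓝 l)) :
    Tendsto (fun n : ℕ => (∑ k ∈ Finset.range n, d k) / n) atTop (𝓝 0) := by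
  set s : ℕ → ℝ := fun n => ∑ k ∈ Finset.range n, d k / (k + 1) with hs
  -- Summation by parts.
  have hparts : ∀ n : ℕ, ∑ k ∈ Finset.range n, d k = n * s n - ∑ k ∈ Finset.range n, s k := by
    intro n
    induction n with
    | zero => simp
    | succ n ih =>
      have h1 : s (n + 1) = s n + d n / (n + 1) := Finset.sum_range_succ _ _
      rw [Finset.sum_range_succ, Finset.sum_range_succ, ih, h1]
      have : (n : ℝ) + 1 ≠ 0 := by positivity
      push_cast
      field_simp
      ring
  have hc := h.sub h.cesaro
  rw [sub_self] at hc
  refine hc.congr' ?_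
  filter_upwards [eventually_gt_atTop 0] with n hn
  have : (n : ℝ) ≠ 0 := by exact_mod_cast hn.ne'
  rw [hparts n]
  field_simp

section StrongLaw

variable {Ω : Type*} {mΩ : MeasurableSpace Ω} {μ : Measure Ω} [IsProbabilityMeasure μ]

/-- The increments `X k - E[X k | ℱ k]` average out almost surely when the second moments of the
`X k` are summable against `(k + 1)⁻²`: the weighted sums form a martingale bounded in `L²`, so
Kronecker's lemma applies. -/
theorem ae_tendsto_average_sub_condExp {ℱ : Filtration ℕ mΩ} {X : ℕ → Ω → ℝ} {b : ℕ → ℝ}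
    (hX : ∀ n, StronglyMeasurable[ℱ (n + 1)] (X n)) (hb : ∀ n ω, |X n ω| ≤ b n)
    (hsum : Summable fun n : ℕ => (∫ ω, X n ω ^ 2 ∂μ) / ((n : ℝ) + 1) ^ 2) :
    ∀ᵐ ω ∂μ, Tendsto
      (fun n : ℕ => (∑ k ∈ Finset.range n, (X k ω - (μ[X k | ℱ k]) ω)) / n) atTop (𝓝 0) := by
  have hXL : ∀ n, MemLp (X n) 2 μ := fun n =>
    (memLp_top_of_bound ((hX n).mono (ℱ.le _)).aestronglyMeasurable (b n)
      (ae_of_all _ fun ω => by simpa using hb n ω)).mono_exponent le_top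
  set D : ℕ → Ω → ℝ := fun k => ((k : ℝ) + 1)⁻¹ • (X k - μ[X k | ℱ k]) with hD
  set W : ℕ → Ω → ℝ := fun n => ∑ k ∈ Finset.range n, D k with hW
  have hWs : ∀ n, W (n + 1) = W n + D n := fun n => Finset.sum_range_succ _ _
  have hDL : ∀ n, MemLp (D n) 2 μ := fun n => ((hXL n).sub ((hXL n).condExp one_le_two)).const_smul _
  have hWL : ∀ n, MemLp (W n) 2 μ := fun n => memLp_finsetSum' _ fun k _ => hDL k
  have hDm : ∀ n, StronglyMeasurable[ℱ (n + 1)] (D n) := fun n =>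
    ((hX n).sub (stronglyMeasurable_condExp.mono (ℱ.mono n.le_succ))).const_smul _
  have hWm : StronglyAdapted ℱ W := fun n =>
    Finset.stronglyMeasurable_sum _ fun k hk =>
      (hDm k).mono (ℱ.mono (Nat.succ_le_of_lt (Finset.mem_range.1 hk)))
  have hDce : ∀ n, μ[D n | ℱ n] =ᵐ[μ] 0 := fun n => by
    have hXi : Integrable (X n) μ := (hXL n).integrable one_le_two
    have h1 := condExp_sub hXi (integrable_condExp (μ := μ) (m := ℱ n) (f := X n)) (ℱ n)
    have h2 : μ[μ[X n | ℱ n] | ℱ n] = μ[X n | ℱ n] :=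
      condExp_of_stronglyMeasurable (ℱ.le n) stronglyMeasurable_condExp integrable_condExp
    have h3 := condExp_smul (μ := μ) (((n : ℝ) + 1)⁻¹) (X n - μ[X n | ℱ n]) (ℱ n)
    filter_upwards [h1, h3] with ω h1 h3
    simp only [hD]
    rw [h3, Pi.smul_apply, h1, h2]
    simp
  have hmart : Martingale W ℱ μ :=
    martingale_of_condExp_sub_eq_zero_nat hWm (fun n => (hWL n).integrable one_le_two) fun n => by
      rw [hWs, add_sub_cancel_left]
      exact hDce n
  have hDsq : ∀ n, ∫ ω, D n ω ^ 2 ∂μ ≤ (∫ ω, X n ω ^ 2 ∂μ) / ((n : ℝ) + 1) ^ 2 := fun n => by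
    have h1 : ∫ ω, (X n ω - (μ[X n | ℱ n]) ω) ^ 2 ∂μ ≤ ∫ ω, X n ω ^ 2 ∂μ := by
      have h2 : ∫ ω, (Var[X n; μ | ℱ n]) ω ∂μ = ∫ ω, (X n ω - (μ[X n | ℱ n]) ω) ^ 2 ∂μ :=
        integral_condExp (ℱ.le n)
      have h3 : ∫ ω, (μ[X n ^ 2 | ℱ n]) ω ∂μ = ∫ ω, X n ω ^ 2 ∂μ := integral_condExp (ℱ.le n)
      rw [← h2, ← h3]
      exact integral_mono_ae integrable_condVar integrable_condExp
        (condVar_ae_le_condExp_sq (ℱ.le n) (hXL n))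
    have h4 : ∫ ω, D n ω ^ 2 ∂μ =
        (∫ ω, (X n ω - (μ[X n | ℱ n]) ω) ^ 2 ∂μ) / ((n : ℝ) + 1) ^ 2 := by
      rw [← integral_div]
      refine integral_congr_ae (ae_of_all _ fun ω => ?_)
      simp only [hD, Pi.smul_apply, Pi.sub_apply, smul_eq_mul]
      rw [mul_pow, inv_pow, inv_mul_eq_div]
    rw [h4]
    exact div_le_div_of_nonneg_right h1 (by positivity)
  have hWsq : ∀ n, ∫ ω, W n ω ^ 2 ∂μ ≤
      ∑ k ∈ Finset.range n, (∫ ω, X k ω ^ 2 ∂μ) / ((k : ℝ) + 1) ^ 2 := by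
    intro n
    induction n with
    | zero => simp [hW]
    | succ n ih =>
      rw [Finset.sum_range_succ]
      have hWD : Integrable (W n * D n) μ := (hWL n).integrable_mul (hDL n)
      -- Martingale increments are orthogonal to the past.
      have h0 : ∫ ω, (W n * D n) ω ∂μ = 0 := by
        rw [← integral_condExp (ℱ.le n)]
        have h1 := condExp_mul_of_stronglyMeasurable_left (hWm n) hWD
          ((hDL n).integrable one_le_two)
        refine (integral_congr_ae (g := fun _ => (0 : ℝ)) ?_).trans (by simp)
        filter_upwards [h1, hDce n] with ω h1 h2
        rw [h1, Pi.mul_apply, h2]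
        simp
      have h2 : ∫ ω, W (n + 1) ω ^ 2 ∂μ =
          ∫ ω, W n ω ^ 2 ∂μ + 2 * ∫ ω, (W n * D n) ω ∂μ + ∫ ω, D n ω ^ 2 ∂μ := by
        have hi : Integrable (fun ω => W n ω ^ 2 + 2 * (W n * D n) ω) μ :=
          (hWL n).integrable_sq.add (hWD.const_mul 2)
        rw [← integral_const_mul, ← integral_add (hWL n).integrable_sq (hWD.const_mul 2),
          ← integral_add hi (hDL n).integrable_sq]
        refine integral_congr_ae (ae_of_all _ fun ω => ?_)
        simp only [hWs, Pi.add_apply, Pi.mul_apply]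
        ring
      rw [h2, h0]
      linarith [hDsq n]
  set C : ℝ := ∑' k : ℕ, (∫ ω, X k ω ^ 2 ∂μ) / ((k : ℝ) + 1) ^ 2
  have hbdd : ∀ n, eLpNorm (W n) 1 μ ≤ ((1 + C).toNNReal : ℝ≥0∞) := fun n => by
    have h1 : ∫ ω, W n ω ^ 2 ∂μ ≤ C :=
      (hWsq n).trans (hsum.sum_le_tsum _ fun k _ =>
        div_nonneg (integral_nonneg fun ω => sq_nonneg _) (sq_nonneg _))
    have hint : Integrable (fun ω => 1 + W n ω ^ 2) μ :=
      (integrable_const (1 : ℝ)).add (hWL n).integrable_sq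
    rw [eLpNorm_one_eq_lintegral_enorm]
    calc ∫⁻ ω, ‖W n ω‖ₑ ∂μ ≤ ∫⁻ ω, ENNReal.ofReal (1 + W n ω ^ 2) ∂μ := by
          refine lintegral_mono fun ω => ?_
          rw [Real.enorm_eq_ofReal_abs]
          refine ENNReal.ofReal_le_ofReal ?_
          nlinarith [sq_nonneg (|W n ω| - 1), sq_abs (W n ω), abs_nonneg (W n ω)]
      _ = ENNReal.ofReal (∫ ω, (1 + W n ω ^ 2) ∂μ) :=
          (ofReal_integral_eq_lintegral_ofReal hint (ae_of_all _ fun ω => by positivity)).symm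
      _ ≤ ENNReal.ofReal (1 + C) := by
          refine ENNReal.ofReal_le_ofReal ?_
          rw [integral_add (integrable_const _) (hWL n).integrable_sq]
          simpa using h1
  filter_upwards [hmart.submartingale.ae_tendsto_limitProcess hbdd] with ω hω
  refine tendsto_average_of_tendsto_sum_div (hω.congr fun n => ?_)
  simp only [hW, hD, Finset.sum_apply, Pi.smul_apply, Pi.sub_apply, smul_eq_mul]
  exact Finset.sum_congr rfl fun k _ => inv_mul_eq_div _ _

end StrongLaw

/-! ### Tail control for the norms of the replacement matrices -/

section Tail

variable {Ω : Type*} {mΩ : MeasurableSpace Ω} {μ : Measure Ω}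

/-- What the argument needs to know about the sizes `X n` of the replacements: truncation at level
`n + 1` almost surely changes finitely many terms and leaves second moments that are summable against
`(n + 1)⁻²` (both are contained in `sum_ne_top`), and the `X n` are uniformly integrable. -/
structure TailControl (μ : Measure Ω) (X : ℕ → Ω → ℝ≥0) : Prop where
  measurable : ∀ n, Measurable (X n)
  sum_ne_top : ∑' n : ℕ, ∫⁻ ω, ENNReal.ofReal ((min (X n ω : ℝ) (n + 1) / (n + 1)) ^ 2) ∂μ ≠ ∞
  unif : ∀ ε : ℝ, 0 < ε → ∃ a : ℝ, 0 ≤ a ∧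
    ∀ n, ∫⁻ ω, ENNReal.ofReal ((X n ω : ℝ) - a) ∂μ ≤ ENNReal.ofReal ε

lemma TailControl.ae_eventually_le {X : ℕ → Ω → ℝ≥0} (h : TailControl μ X) :
    ∀ᵐ ω ∂μ, ∀ᶠ n : ℕ in atTop, (X n ω : ℝ) ≤ n + 1 := by
  have hm : ∀ n : ℕ, Measurable fun ω =>
      ENNReal.ofReal ((min (X n ω : ℝ) (n + 1) / (n + 1)) ^ 2) := fun n => by
    have := h.measurable n
    fun_prop
  have h1 := h.sum_ne_top
  rw [← lintegral_tsum fun n => (hm n).aemeasurable] at h1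
  filter_upwards [ae_lt_top (Measurable.tsum hm) h1] with ω hω
  filter_upwards [(ENNReal.tendsto_atTop_zero_of_tsum_ne_top hω.ne).eventually_lt_const
    one_pos] with n hn
  by_contra hcon
  rw [min_eq_right (not_le.1 hcon).le, div_self (by positivity)] at hn
  simp at hn

lemma TailControl.summable_sq {X : ℕ → Ω → ℝ≥0} (h : TailControl μ X) {Z : ℕ → Ω → ℝ}
    (hZm : ∀ n, Measurable (Z n)) (hZ : ∀ (n : ℕ) ω, |Z n ω| ≤ min (X n ω : ℝ) (n + 1)) :
    Summable fun n : ℕ => (∫ ω, Z n ω ^ 2 ∂μ) / ((n : ℝ) + 1) ^ 2 := by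
  have h1 : ∑' n : ℕ, ∫⁻ ω, ENNReal.ofReal ((Z n ω / (n + 1)) ^ 2) ∂μ ≠ ∞ := by
    refine ne_top_of_le_ne_top h.sum_ne_top (ENNReal.tsum_le_tsum fun n =>
      lintegral_mono fun ω => ENNReal.ofReal_le_ofReal ?_)
    rw [← sq_abs, abs_div, abs_of_pos (show (0 : ℝ) < n + 1 by positivity)]
    exact pow_le_pow_left₀ (by positivity) (div_le_div_of_nonneg_right (hZ n ω) (by positivity)) 2
  refine (ENNReal.summable_toReal h1).congr fun n => ?_
  rw [← integral_div, integral_eq_lintegral_of_nonneg_ae (ae_of_all _ fun ω => by positivity)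
    (by have := hZm n; fun_prop)]
  simp_rw [div_pow]

lemma lintegral_ofReal_le_of_meas_lt_le {Ω' : Type*} {mΩ' : MeasurableSpace Ω'} {ν : Measure Ω'}
    {f : Ω → ℝ} {g : Ω' → ℝ} (hf : Measurable f) (hf0 : ∀ ω, 0 ≤ f ω) (hg : Measurable g)
    (hg0 : ∀ ω, 0 ≤ g ω) {c : ℝ≥0∞} (hc : c ≠ ∞)
    (h : ∀ t, 0 < t → μ {ω | t < f ω} ≤ c * ν {ω | t < g ω}) :
    ∫⁻ ω, ENNReal.ofReal (f ω) ∂μ ≤ c * ∫⁻ ω, ENNReal.ofReal (g ω) ∂ν := by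
  rw [lintegral_eq_lintegral_meas_lt μ (ae_of_all _ hf0) hf.aemeasurable,
    lintegral_eq_lintegral_meas_lt ν (ae_of_all _ hg0) hg.aemeasurable,
    ← lintegral_const_mul' _ _ hc]
  exact setLIntegral_mono' measurableSet_Ioi fun t ht => h t ht

/-- The truncated second moments of a random variable are summable when its mean is finite, in
pointwise form. -/
lemma sum_min_div_sq_le {x : ℝ} (hx : 0 ≤ x) (N : ℕ) :
    ∑ n ∈ Finset.range N, (min x (n + 1) / ((n : ℝ) + 1)) ^ 2 ≤ 3 * x := by
  -- The summands are dominated by the decrements of a nonnegative sequence.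
  suffices h : ∑ n ∈ Finset.range N, (min x (n + 1) / ((n : ℝ) + 1)) ^ 2 ≤
      3 * x - (2 * x ^ 2 / max ((N : ℝ) + 1) x + max (x - (N + 1)) 0) by
    have h1 : 0 ≤ 2 * x ^ 2 / max ((N : ℝ) + 1) x := by positivity
    have h2 : 0 ≤ max (x - ((N : ℝ) + 1)) 0 := le_max_right _ _
    linarith
  induction N with
  | zero =>
    simp only [Finset.range_zero, Finset.sum_empty, Nat.cast_zero, zero_add]
    have h1 : 2 * x ^ 2 / max 1 x ≤ 2 * x := by
      rw [div_le_iff₀ (by positivity)]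
      nlinarith [le_max_right 1 x]
    have h2 : max (x - 1) 0 ≤ x := max_le (by linarith) hx
    linarith
  | succ N ih =>
    rw [Finset.sum_range_succ]
    push_cast
    set m : ℝ := (N : ℝ) + 1 with hm
    have hm1 : 1 ≤ m := by rw [hm]; linarith [Nat.cast_nonneg (α := ℝ) N]
    have hm0 : 0 < m := by linarith
    suffices h : (min x m / m) ^ 2 ≤ (2 * x ^ 2 / max m x + max (x - m) 0) -
        (2 * x ^ 2 / max (m + 1) x + max (x - (m + 1)) 0) by linarith
    rcases le_total x m with h1 | h1
    · rw [min_eq_left h1, max_eq_left h1, max_eq_left (show x ≤ m + 1 by linarith),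
        max_eq_right (show x - m ≤ 0 by linarith), max_eq_right (show x - (m + 1) ≤ 0 by linarith)]
      have : 2 * x ^ 2 / m + 0 - (2 * x ^ 2 / (m + 1) + 0) = x ^ 2 * (2 / (m * (m + 1))) := by
        field_simp
        ring
      rw [this, div_pow, div_eq_mul_inv]
      refine mul_le_mul_of_nonneg_left ?_ (sq_nonneg x)
      rw [inv_eq_one_div, div_le_div_iff₀ (by positivity) (by positivity)]
      nlinarith
    · rw [min_eq_right h1, div_self hm0.ne', max_eq_right h1,
        max_eq_left (show 0 ≤ x - m by linarith)]
      have hx0 : 0 < x := by linarith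
      have h4 : 2 * x ^ 2 / x = 2 * x := by field_simp
      rw [h4]
      rcases le_total x (m + 1) with h2 | h2
      · rw [max_eq_left h2, max_eq_right (show x - (m + 1) ≤ 0 by linarith)]
        have h3 : 2 * x ^ 2 / (m + 1) ≤ 3 * x - m - 1 := by
          rw [div_le_iff₀ (by linarith)]
          nlinarith [mul_nonneg (sub_nonneg.2 h2) (sub_nonneg.2 h1),
            mul_nonneg (sub_nonneg.2 h2) (sub_nonneg.2 hm1)]
        linarith
      · rw [max_eq_right h2, max_eq_left (show 0 ≤ x - (m + 1) by linarith), h4]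
        linarith

variable [IsProbabilityMeasure μ]

/-- Tail control under a stochastic majorant with finite mean: monotone functions of `X n` have
expectations bounded by those of the majorant, by the layer cake formula. -/
lemma tailControl_of_meas_lt_le {X : ℕ → Ω → ℝ≥0} (hX : ∀ n, Measurable (X n)) {c : ℝ}
    {ν : Measure ℝ} [IsProbabilityMeasure ν] (hν : Integrable (fun x => x) ν)
    (hc : 0 < c)
    (h : ∀ n, ∀ x : ℝ, 0 < x → μ.real {ω | x < X n ω} ≤ c * ν.real (Set.Ioi x)) :
    TailControl μ X := by
  have h' : ∀ n, ∀ x : ℝ, 0 < x → μ {ω | x < X n ω} ≤ ENNReal.ofReal c * ν (Set.Ioi x) :=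
    fun n x hx => by
      rw [← ofReal_measureReal, ← ofReal_measureReal (μ := ν), ← ENNReal.ofReal_mul hc.le]
      exact ENNReal.ofReal_le_ofReal (h n x hx)
  refine ⟨hX, ?_, fun ε hε => ?_⟩
  · have hle : ∀ n : ℕ, ∫⁻ ω, ENNReal.ofReal ((min (X n ω : ℝ) (n + 1) / (n + 1)) ^ 2) ∂μ ≤
        ENNReal.ofReal c * ∫⁻ x, ENNReal.ofReal ((min (max x 0) (n + 1) / ((n : ℝ) + 1)) ^ 2) ∂ν := by
      intro n
      have hXn := hX n
      refine lintegral_ofReal_le_of_meas_lt_le (by fun_prop) (fun _ => sq_nonneg _) (by fun_prop)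
        (fun _ => sq_nonneg _) ENNReal.ofReal_ne_top fun t ht => ?_
      have hn : (0 : ℝ) < n + 1 := by positivity
      have hst : 0 < √t := Real.sqrt_pos.2 ht
      -- Both superlevel sets are given by the same half-line, or both are empty.
      have key : ∀ x : ℝ, 0 ≤ x → (t < (min x (n + 1) / ((n : ℝ) + 1)) ^ 2 ↔
          √t < 1 ∧ √t * (n + 1) < x) := fun x hx => by
        have h0 : 0 ≤ min x ((n : ℝ) + 1) / (n + 1) := by positivity
        have h1 : t < (min x (n + 1) / ((n : ℝ) + 1)) ^ 2 ↔ √t < min x (n + 1) / ((n : ℝ) + 1) :=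
          ⟨fun h => by simpa [Real.sqrt_sq h0] using Real.sqrt_lt_sqrt ht.le h,
            Real.lt_sq_of_sqrt_lt⟩
        rw [h1, lt_div_iff₀ hn, lt_min_iff, and_comm, mul_lt_iff_lt_one_left hn]
      by_cases ht1 : √t < 1
      · have e1 : {ω | t < (min (X n ω : ℝ) (n + 1) / ((n : ℝ) + 1)) ^ 2} =
            {ω | √t * (n + 1) < X n ω} := by
          ext ω
          simp only [Set.mem_ofPred_eq, key _ (X n ω).coe_nonneg, ht1, true_and]
        have e2 : {x : ℝ | t < (min (max x 0) (n + 1) / ((n : ℝ) + 1)) ^ 2} =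
            Set.Ioi (√t * (n + 1)) := by
          ext x
          have hpos : 0 < √t * ((n : ℝ) + 1) := mul_pos hst hn
          simp only [Set.mem_ofPred_eq, key _ (le_max_right x 0), ht1, true_and, Set.mem_Ioi,
            lt_max_iff, hpos.not_gt, or_false]
        rw [e1, e2]
        exact h' n _ (mul_pos hst hn)
      · have e1 : {ω | t < (min (X n ω : ℝ) (n + 1) / ((n : ℝ) + 1)) ^ 2} = ∅ := by
          ext ω
          simp only [Set.mem_ofPred_eq, key _ (X n ω).coe_nonneg, ht1, false_and,
            Set.mem_empty_iff_false]
        rw [e1, measure_empty]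
        exact zero_le
    refine ne_top_of_le_ne_top ?_ (ENNReal.tsum_le_tsum hle)
    rw [ENNReal.tsum_mul_left, ← lintegral_tsum fun n => by fun_prop]
    refine ENNReal.mul_ne_top ENNReal.ofReal_ne_top ?_
    have hint : Integrable (fun x : ℝ => 3 * max x 0) ν := hν.pos_part.const_mul 3
    refine ne_top_of_le_ne_top hint.lintegral_lt_top.ne (lintegral_mono fun x => ?_)
    refine ENNReal.tsum_le_of_sum_range_le fun N => ?_
    rw [← ENNReal.ofReal_sum_of_nonneg fun _ _ => sq_nonneg _]
    exact ENNReal.ofReal_le_ofReal (sum_min_div_sq_le (le_max_right x 0) N)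
  · have hlim : Tendsto (fun m : ℕ => ENNReal.ofReal c * ∫⁻ x, ENNReal.ofReal (x - m) ∂ν) atTop
        (𝓝 (ENNReal.ofReal c * 0)) := by
      refine ENNReal.Tendsto.const_mul ?_ (Or.inr ENNReal.ofReal_ne_top)
      rw [show (0 : ℝ≥0∞) = ∫⁻ _ : ℝ, 0 ∂ν by simp]
      refine tendsto_lintegral_of_dominated_convergence (fun x => ENNReal.ofReal x)
        (fun m => by fun_prop) (fun m => ae_of_all _ fun x => ENNReal.ofReal_le_ofReal (by simp))
        hν.lintegral_lt_top.ne (ae_of_all _ fun x => ?_)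
      obtain ⟨N, hN⟩ := exists_nat_ge x
      refine tendsto_const_nhds.congr' ?_
      filter_upwards [eventually_ge_atTop N] with m hm
      have : (N : ℝ) ≤ m := by exact_mod_cast hm
      exact (ENNReal.ofReal_of_nonpos (by linarith)).symm
    rw [mul_zero] at hlim
    obtain ⟨m, hm⟩ := (hlim.eventually_lt_const (ENNReal.ofReal_pos.2 hε)).exists
    refine ⟨m, m.cast_nonneg, fun n => le_trans ?_ hm.le⟩
    have hpos : ∀ x : ℝ, ENNReal.ofReal (x - m) = ENNReal.ofReal (max (x - m) 0) := fun x => by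
      rw [ENNReal.ofReal_max, ENNReal.ofReal_zero, max_eq_left zero_le]
    simp_rw [hpos]
    have hXn := hX n
    refine lintegral_ofReal_le_of_meas_lt_le (by fun_prop) (fun _ => le_max_right _ _)
      (by fun_prop) (fun _ => le_max_right _ _) ENNReal.ofReal_ne_top fun t ht => ?_
    have key : ∀ x : ℝ, t < max (x - m) 0 ↔ t + m < x := fun x => by
      rw [lt_max_iff, or_iff_left ht.not_gt, lt_sub_iff_add_lt]
    simp_rw [key]
    exact h' n _ (add_pos_of_pos_of_nonneg ht m.cast_nonneg)

/-- Tail control under a uniform moment bound: since `φ` and `x / φ x` are eventually monotone,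
`min x N ^ 2 / N ^ 2` is at most `x φ(x) / (N φ(N))` for large `x` and `N`, and `φ` is unbounded. -/
lemma tailControl_of_moment {X : ℕ → Ω → ℝ≥0} (hX : ∀ n, Measurable (X n)) {φ : ℝ≥0 → ℝ≥0}
    {x₀ : ℝ≥0} (hφpos : ∀ x, x₀ ≤ x → 0 < φ x) (hφmono : MonotoneOn φ (Set.Ici x₀))
    (hφdiv : MonotoneOn (fun x => x / φ x) (Set.Ici x₀))
    (hφsum : Summable (fun n : ℕ => 1 / ((n : ℝ≥0) * φ n)))
    (hB : ⨆ n : ℕ, ∫⁻ ω, ((X n ω * φ (X n ω) : ℝ≥0) : ℝ≥0∞) ∂μ < ∞) :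
    TailControl μ X := by
  set B := ⨆ n : ℕ, ∫⁻ ω, ((X n ω * φ (X n ω) : ℝ≥0) : ℝ≥0∞) ∂μ with hBdef
  have hBn : ∀ n : ℕ, ∫⁻ ω, ((X n ω * φ (X n ω) : ℝ≥0) : ℝ≥0∞) ∂μ ≤ B := fun n =>
    le_iSup (fun n : ℕ => ∫⁻ ω, ((X n ω * φ (X n ω) : ℝ≥0) : ℝ≥0∞) ∂μ) n
  refine ⟨hX, ?_, fun ε hε => ?_⟩
  · -- The pointwise bound behind the summability, for the truncation level `N ≥ 1`.
    have key : ∀ (N x : ℝ≥0), 0 < N →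
        (min x N / N) ^ 2 ≤ x₀ ^ 2 * (1 / N ^ 2) + 1 / (N * φ N) * (x * φ x) := by
      intro N x hN
      rw [div_pow]
      rcases lt_or_ge N x₀ with hN0 | hN0
      · refine le_add_right ?_
        rw [mul_one_div]
        exact div_le_div_of_nonneg_right
          (pow_le_pow_left₀ zero_le ((min_le_right _ _).trans hN0.le) 2) zero_le
      have hφN := hφpos N hN0
      rcases lt_or_ge x x₀ with hx | hx
      · refine le_add_right ?_
        rw [mul_one_div]
        exact div_le_div_of_nonneg_right
          (pow_le_pow_left₀ zero_le ((min_le_left _ _).trans hx.le) 2) zero_le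
      · refine le_add_left ?_
        have hφx := hφpos x hx
        rw [one_div_mul_eq_div, div_le_div_iff₀ (by positivity) (by positivity)]
        rcases le_total x N with hxN | hxN
        · have h1 := hφdiv hx hN0 hxN
          simp only at h1
          rw [div_le_div_iff₀ hφx hφN] at h1
          rw [min_eq_left hxN]
          calc x ^ 2 * (N * φ N) = x * N * (x * φ N) := by ring
            _ ≤ x * N * (N * φ x) := mul_le_mul_of_nonneg_left h1 zero_le
            _ = x * φ x * N ^ 2 := by ring
        · have h1 := hφmono hN0 hx hxN
          rw [min_eq_right hxN, mul_comm]
          exact mul_le_mul_of_nonneg_right (mul_le_mul' hxN h1) zero_le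
    have hle : ∀ n : ℕ, ∫⁻ ω, ENNReal.ofReal ((min (X n ω : ℝ) (n + 1) / (n + 1)) ^ 2) ∂μ ≤
        ((x₀ ^ 2 * (1 / ((n + 1 : ℕ) : ℝ≥0) ^ 2) : ℝ≥0) : ℝ≥0∞) +
          ((1 / (((n + 1 : ℕ) : ℝ≥0) * φ ((n + 1 : ℕ) : ℝ≥0)) : ℝ≥0) : ℝ≥0∞) * B := by
      intro n
      refine le_trans ?_ (add_le_add le_rfl (mul_le_mul_right (hBn n) _))
      rw [← lintegral_const_mul' _ _ ENNReal.coe_ne_top]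
      calc ∫⁻ ω, ENNReal.ofReal ((min (X n ω : ℝ) (n + 1) / (n + 1)) ^ 2) ∂μ
          ≤ ∫⁻ ω, ((x₀ ^ 2 * (1 / ((n + 1 : ℕ) : ℝ≥0) ^ 2) : ℝ≥0) : ℝ≥0∞) +
            ((1 / (((n + 1 : ℕ) : ℝ≥0) * φ ((n + 1 : ℕ) : ℝ≥0)) : ℝ≥0) : ℝ≥0∞) *
              ((X n ω * φ (X n ω) : ℝ≥0) : ℝ≥0∞) ∂μ := by
            refine lintegral_mono fun ω => ?_
            have h1 := key ((n + 1 : ℕ) : ℝ≥0) (X n ω) (by positivity)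
            rw [← ENNReal.coe_mul, ← ENNReal.coe_add]
            refine le_trans (le_of_eq ?_) (ENNReal.coe_le_coe.2 h1)
            rw [← ENNReal.ofReal_coe_nnreal]
            push_cast
            rfl
        _ = _ := by
            rw [lintegral_add_left measurable_const, lintegral_const, measure_univ, mul_one]
    refine ne_top_of_le_ne_top ?_ (ENNReal.tsum_le_tsum hle)
    rw [ENNReal.tsum_add, ENNReal.tsum_mul_right]
    refine ENNReal.add_ne_top.2 ⟨?_, ENNReal.mul_ne_top ?_ hB.ne⟩
    · refine ENNReal.tsum_coe_ne_top_iff_summable.2 (Summable.mul_left _ ?_)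
      refine (NNReal.summable_nat_add_iff (f := fun n : ℕ => 1 / (n : ℝ≥0) ^ 2) 1).2 ?_
      rw [← NNReal.summable_coe]
      push_cast
      exact Real.summable_one_div_nat_pow.2 one_lt_two
    · exact ENNReal.tsum_coe_ne_top_iff_summable.2
        ((NNReal.summable_nat_add_iff (f := fun n : ℕ => 1 / ((n : ℝ≥0) * φ n)) 1).2 hφsum)
  · -- `φ` is unbounded, as the harmonic series diverges.
    obtain ⟨n, hn0, hn⟩ : ∃ n : ℕ, x₀ ≤ n ∧ B.toNNReal / ε.toNNReal ≤ φ n := by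
      by_contra! hcon
      obtain ⟨N, hN⟩ := exists_nat_ge x₀
      set L := B.toNNReal / ε.toNNReal
      have hs : Summable fun n : ℕ => L * (1 / (((n + N : ℕ) : ℝ≥0) * φ (n + N : ℕ))) :=
        ((NNReal.summable_nat_add_iff (f := fun n : ℕ => 1 / ((n : ℝ≥0) * φ n)) N).2
          hφsum).mul_left L
      have hs' : Summable fun n : ℕ => 1 / ((n + N : ℕ) : ℝ≥0) := by
        refine NNReal.summable_of_le (fun n => ?_) hs
        have h0 : x₀ ≤ ((n + N : ℕ) : ℝ≥0) := hN.trans (by push_cast; exact le_add_self)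
        have h1 := hcon (n + N) h0
        have h2 := hφpos _ h0
        rcases Nat.eq_zero_or_pos (n + N) with h3 | h3
        · simp [h3]
        have h4 : (0 : ℝ≥0) < ((n + N : ℕ) : ℝ≥0) := by exact_mod_cast h3
        rw [mul_one_div, div_le_div_iff₀ h4 (by positivity), one_mul, mul_comm]
        exact mul_le_mul_of_nonneg_right h1.le zero_le
      have hs'' := (NNReal.summable_nat_add_iff (f := fun n : ℕ => 1 / (n : ℝ≥0)) N).1 hs'
      rw [← NNReal.summable_coe] at hs''
      push_cast at hs''
      exact Real.not_summable_one_div_natCast hs''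
    refine ⟨n, n.cast_nonneg, fun k => ?_⟩
    have hφn := hφpos _ hn0
    have h1 : ∀ x : ℝ≥0, ENNReal.ofReal ((x : ℝ) - n) ≤
        ((1 / φ n : ℝ≥0) : ℝ≥0∞) * ((x * φ x : ℝ≥0) : ℝ≥0∞) := fun x => by
      rcases le_total x n with hx | hx
      · have : (x : ℝ) - n ≤ 0 := by
          have : (x : ℝ) ≤ n := by exact_mod_cast hx
          linarith
        rw [ENNReal.ofReal_of_nonpos this]
        exact zero_le
      · rw [← ENNReal.coe_mul]
        have h2 : ENNReal.ofReal ((x : ℝ) - n) ≤ ENNReal.ofReal (x : ℝ) :=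
          ENNReal.ofReal_le_ofReal (by simp)
        rw [ENNReal.ofReal_coe_nnreal] at h2
        refine h2.trans (ENNReal.coe_le_coe.2 ?_)
        rw [one_div_mul_eq_div, le_div_iff₀ hφn]
        exact mul_le_mul_of_nonneg_left (hφmono hn0 (hn0.trans hx) hx) zero_le
    calc ∫⁻ ω, ENNReal.ofReal ((X k ω : ℝ) - n) ∂μ
        ≤ ∫⁻ ω, ((1 / φ n : ℝ≥0) : ℝ≥0∞) * ((X k ω * φ (X k ω) : ℝ≥0) : ℝ≥0∞) ∂μ :=
          lintegral_mono fun ω => h1 _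
      _ ≤ ((1 / φ n : ℝ≥0) : ℝ≥0∞) * B := by
          rw [lintegral_const_mul' _ _ ENNReal.coe_ne_top]
          exact mul_le_mul_right (hBn k) _
      _ ≤ ENNReal.ofReal ε := by
          rw [← ENNReal.coe_toNNReal hB.ne, ← ENNReal.coe_mul, ENNReal.ofReal,
            ENNReal.coe_le_coe, one_div_mul_eq_div, div_le_iff₀ hφn]
          rwa [div_le_iff₀ (Real.toNNReal_pos.2 hε), mul_comm] at hn

end Tail

/-! ### Conditional independence and the one-step prediction -/

namespace RandomUrn

section CondIndep

variable {Ω β γ : Type*} [MeasurableSpace β] [MeasurableSpace γ] {m mΩ : MeasurableSpace Ω}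
  {μ : Measure Ω} [IsProbabilityMeasure μ] {f : Ω → β} {g : Ω → γ}

/-- The product rule for conditional probabilities extends from sets `g ⁻¹' B` to bounded functions
of `g`: integrated over a set of `m`, both sides are integrals of `h` against a finite measure, and
the rule says that the two measures agree. -/
lemma CondIndependent.condExp_indicator_mul (hfg : CondIndependent μ m f g) (hm : m ≤ mΩ)
    (hf : Measurable f) (hg : Measurable g) {A : Set β} (hA : MeasurableSet A) {h : γ → ℝ}
    (hh : Measurable h) {b : ℝ} (hb : ∀ x, |h x| ≤ b) :
    μ[(f ⁻¹' A).indicator (fun ω => h (g ω)) | m] =ᵐ[μ]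
      fun ω => (μ⟦f ⁻¹' A | m⟧) ω * (μ[fun ω => h (g ω) | m]) ω := by
  set Q : Ω → ℝ := μ⟦f ⁻¹' A | m⟧ with hQ
  have hQm : StronglyMeasurable[m] Q := stronglyMeasurable_condExp
  have hQm' : Measurable Q := (hQm.mono hm).measurable
  have hQi : Integrable Q μ := integrable_condExp
  have hfA : MeasurableSet (f ⁻¹' A) := hf hA
  have hQ0 : ∀ᵐ ω ∂μ, 0 ≤ Q ω := condExp_nonneg (ae_of_all _ fun ω =>
    Set.indicator_nonneg (fun _ _ => zero_le_one) ω)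
  have hhb : ∀ᵐ ω ∂μ, ‖h (g ω)‖ ≤ b := ae_of_all _ fun ω => by simpa using hb (g ω)
  have hhm : AEStronglyMeasurable (fun ω => h (g ω)) μ := (hh.comp hg).aestronglyMeasurable
  have hhi : Integrable (fun ω => h (g ω)) μ := Integrable.of_bound hhm b hhb
  have hQh : Integrable (fun ω => Q ω * h (g ω)) μ := hQi.mul_bdd hhm hhb
  have hset : ∀ F, MeasurableSet[m] F →
      ∫ ω in F, (f ⁻¹' A).indicator (fun ω => h (g ω)) ω ∂μ = ∫ ω in F, Q ω * h (g ω) ∂μ := by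
    intro F hF
    have hF' := hm F hF
    have hmeas : (μ.restrict (F ∩ f ⁻¹' A)).map g =
        ((μ.restrict F).withDensity fun ω => ENNReal.ofReal (Q ω)).map g := by
      ext B hB
      have hgB : MeasurableSet (g ⁻¹' B) := hg hB
      rw [Measure.map_apply hg hB, Measure.map_apply hg hB, Measure.restrict_apply hgB,
        withDensity_apply _ hgB, Measure.restrict_restrict hgB,
        ← ofReal_integral_eq_lintegral_ofReal hQi.restrict (ae_restrict_of_ae hQ0),
        ← ofReal_measureReal]
      congr 1
      have hI : Integrable ((g ⁻¹' B).indicator fun _ => (1 : ℝ)) μ :=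
        (integrable_const 1).indicator hgB
      have hI2 : Integrable (fun ω => Q ω * (g ⁻¹' B).indicator (fun _ => (1 : ℝ)) ω) μ :=
        hQi.mul_bdd (c := 1) hI.aestronglyMeasurable (ae_of_all _ fun ω => by
          by_cases hω : ω ∈ g ⁻¹' B <;> simp [hω])
      have hpull : μ[fun ω => Q ω * (g ⁻¹' B).indicator (fun _ => (1 : ℝ)) ω | m] =ᵐ[μ]
          fun ω => Q ω * (μ⟦g ⁻¹' B | m⟧) ω :=
        condExp_mul_of_stronglyMeasurable_left hQm hI2 hI
      calc μ.real (g ⁻¹' B ∩ (F ∩ f ⁻¹' A))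
          = ∫ ω in F, (f ⁻¹' A ∩ g ⁻¹' B).indicator (fun _ => (1 : ℝ)) ω ∂μ := by
            rw [setIntegral_indicator (hfA.inter hgB), setIntegral_const, smul_eq_mul, mul_one]
            congr 1
            ext ω
            simp only [Set.mem_inter_iff]
            tauto
        _ = ∫ ω in F, (μ⟦f ⁻¹' A ∩ g ⁻¹' B | m⟧) ω ∂μ :=
            (setIntegral_condExp hm ((integrable_const 1).indicator (hfA.inter hgB)) hF).symm
        _ = ∫ ω in F, (μ[fun ω => Q ω * (g ⁻¹' B).indicator (fun _ => (1 : ℝ)) ω | m]) ω ∂μ := by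
            refine setIntegral_congr_ae hF' ?_
            filter_upwards [hfg A B hA hB, hpull] with ω h1 h2 _
            rw [h1, h2]
        _ = ∫ ω in F, Q ω * (g ⁻¹' B).indicator (fun _ => (1 : ℝ)) ω ∂μ :=
            setIntegral_condExp hm hI2 hF
        _ = ∫ ω in g ⁻¹' B ∩ F, Q ω ∂μ := by
            rw [Set.inter_comm, ← setIntegral_indicator hgB]
            refine integral_congr_ae (ae_of_all _ fun ω => ?_)
            by_cases hω : ω ∈ g ⁻¹' B <;> simp [hω]
    rw [setIntegral_indicator hfA]
    have h1 : ∫ x, h x ∂((μ.restrict (F ∩ f ⁻¹' A)).map g) = ∫ ω in F ∩ f ⁻¹' A, h (g ω) ∂μ :=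
      integral_map hg.aemeasurable hh.aestronglyMeasurable
    have h2 : ∫ x, h x ∂(((μ.restrict F).withDensity fun ω => ENNReal.ofReal (Q ω)).map g) =
        ∫ ω in F, Q ω * h (g ω) ∂μ := by
      rw [integral_map hg.aemeasurable hh.aestronglyMeasurable,
        integral_withDensity_eq_integral_toReal_smul (by fun_prop)
          (ae_of_all _ fun _ => ENNReal.ofReal_lt_top)]
      refine integral_congr_ae ?_
      filter_upwards [ae_restrict_of_ae hQ0] with ω hω
      rw [ENNReal.toReal_ofReal hω, smul_eq_mul]
    rw [← h1, ← h2, hmeas]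
  have hce : μ[fun ω => Q ω * h (g ω) | m] =ᵐ[μ]
      μ[(f ⁻¹' A).indicator (fun ω => h (g ω)) | m] :=
    ae_eq_condExp_of_forall_setIntegral_eq hm (hhi.indicator hfA)
      (fun _ _ _ => integrable_condExp.integrableOn)
      (fun F hF _ => by rw [setIntegral_condExp hm hQh hF, hset F hF])
      stronglyMeasurable_condExp.aestronglyMeasurable
  exact hce.symm.trans (condExp_mul_of_stronglyMeasurable_left hQm hQh hhi)

end CondIndep

/-! ### The urn process -/

section Urn

variable {Ω : Type*} {K : ℕ} {C₀ : Ω → Fin K → ℝ} {J : ℕ → Ω → Fin K}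
  {R : ℕ → Ω → Matrix (Fin K) (Fin K) ℝ}

lemma sum_abs_le_norm (A : Matrix (Fin K) (Fin K) ℝ) (i : Fin K) : ∑ j, |A i j| ≤ ‖A‖ := by
  rw [Matrix.linfty_opNorm_def]
  have h := Finset.le_sup (f := fun i : Fin K => ∑ j, ‖A i j‖₊) (Finset.mem_univ i)
  have h' := NNReal.coe_le_coe.2 h
  push_cast at h'
  simpa using h'

lemma abs_le_norm (A : Matrix (Fin K) (Fin K) ℝ) (i j : Fin K) : |A i j| ≤ ‖A‖ :=
  (Finset.single_le_sum (f := fun j => |A i j|) (fun _ _ => abs_nonneg _)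
    (Finset.mem_univ j)).trans (sum_abs_le_norm A i)

lemma measurable_entry (i j : Fin K) : Measurable fun A : Matrix (Fin K) (Fin K) ℝ => A i j :=
  (measurable_pi_apply j).comp (measurable_pi_apply (X := fun _ : Fin K => Fin K → ℝ) i)

lemma measurable_nnnorm_matrix :
    Measurable fun A : Matrix (Fin K) (Fin K) ℝ => (‖A‖₊ : ℝ≥0) := by
  simp_rw [Matrix.linfty_opNNNorm_def]
  suffices h : ∀ s : Finset (Fin K),
      Measurable fun A : Matrix (Fin K) (Fin K) ℝ => s.sup fun i => ∑ j, ‖A i j‖₊ from h _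
  intro s
  induction s using Finset.induction_on with
  | empty => simp
  | insert i s _ ih =>
    simp_rw [Finset.sup_insert]
    exact (Finset.measurable_fun_sum _ fun j _ => (measurable_entry i j).nnnorm).sup ih

lemma colorIndicator_apply (n : ℕ) (ω : Ω) (i : Fin K) :
    colorIndicator J n ω i = if J n ω = i then 1 else 0 := by
  simp [colorIndicator, Pi.single_apply, eq_comm]

lemma colorIndicator_preimage (n : ℕ) (i : Fin K) :
    colorIndicator J n ⁻¹' {Pi.single i 1} = {ω | J n ω = i} := by
  ext ω
  simp only [Set.mem_preimage, Set.mem_singleton_iff, Set.mem_ofPred_eq, colorIndicator]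
  refine ⟨fun h => ?_, fun h => by rw [h]⟩
  by_contra hne
  have := congrFun h i
  simp [Ne.symm hne] at this

lemma sum_colorIndicator_mul (n : ℕ) (ω : Ω) (v : Fin K → ℝ) :
    ∑ i, colorIndicator J n ω i * v i = v (J n ω) := by
  simp [colorIndicator_apply]

lemma composition_succ_apply (n : ℕ) (ω : Ω) (j : Fin K) :
    composition C₀ J R (n + 1) ω j =
      composition C₀ J R n ω j + R (n + 1) ω (J (n + 1) ω) j := by
  simp only [composition, Pi.add_apply, Matrix.vecMul, dotProduct]
  rw [sum_colorIndicator_mul (n + 1) ω fun i => R (n + 1) ω i j]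

lemma composition_eq_sum (n : ℕ) (ω : Ω) (j : Fin K) :
    composition C₀ J R n ω j =
      C₀ ω j + ∑ k ∈ Finset.range n, R (k + 1) ω (J (k + 1) ω) j := by
  induction n with
  | zero => simp [composition]
  | succ n ih => rw [composition_succ_apply, ih, Finset.sum_range_succ, add_assoc]

lemma colorCount_apply (n : ℕ) (ω : Ω) (i : Fin K) :
    colorCount J n ω i = ∑ k ∈ Finset.range n, colorIndicator J (k + 1) ω i := by
  rw [colorCount, Finset.sum_apply]
  induction n with
  | zero => simp
  | succ n ih => rw [Finset.sum_Icc_succ_top (by omega), Finset.sum_range_succ, ih]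

lemma past_mono : Monotone (past C₀ J R) := fun _ _ hab =>
  sup_le_sup le_rfl (biSup_mono fun _ hk =>
    Finset.mem_Icc.2 ⟨(Finset.mem_Icc.1 hk).1, (Finset.mem_Icc.1 hk).2.trans hab⟩)

lemma comap_le_past_succ (n : ℕ) :
    MeasurableSpace.comap (R (n + 1)) inferInstance ⊔
      MeasurableSpace.comap (colorIndicator J (n + 1)) inferInstance ≤ past C₀ J R (n + 1) :=
  (le_iSup₂_of_le (f := fun m (_ : m ∈ Finset.Icc 1 (n + 1)) =>
    MeasurableSpace.comap (R m) inferInstance ⊔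
      MeasurableSpace.comap (colorIndicator J m) inferInstance) (n + 1)
    (Finset.mem_Icc.2 ⟨by omega, le_rfl⟩) le_rfl).trans le_sup_right

lemma measurable_past_replacement (n : ℕ) : Measurable[past C₀ J R (n + 1)] (R (n + 1)) :=
  measurable_iff_comap_le.2 (le_sup_left.trans (comap_le_past_succ n))

lemma measurable_past_colorIndicator (n : ℕ) :
    Measurable[past C₀ J R (n + 1)] (colorIndicator J (n + 1)) :=
  measurable_iff_comap_le.2 (le_sup_right.trans (comap_le_past_succ n))

/-- The entry `A i j` of a matrix, truncated where the norm exceeds `n + 1`. -/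
noncomputable def truncEntry (n : ℕ) (i j : Fin K) (A : Matrix (Fin K) (Fin K) ℝ) : ℝ :=
  {A : Matrix (Fin K) (Fin K) ℝ | ‖A‖ ≤ (n + 1 : ℕ)}.indicator (fun A => A i j) A

lemma measurable_truncEntry (n : ℕ) (i j : Fin K) : Measurable (truncEntry n i j) :=
  (measurable_entry i j).indicator
    (measurableSet_le (measurable_nnnorm_matrix.coe_nnreal_real) measurable_const)

lemma abs_truncEntry_le (n : ℕ) (i j : Fin K) (A : Matrix (Fin K) (Fin K) ℝ) :
    |truncEntry n i j A| ≤ min ‖A‖ (n + 1) := by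
  by_cases hA : ‖A‖ ≤ (n + 1 : ℕ)
  · rw [truncEntry, Set.indicator_of_mem (by exact hA)]
    exact le_min (abs_le_norm A i j) ((abs_le_norm A i j).trans (by exact_mod_cast hA))
  · rw [truncEntry, Set.indicator_of_notMem (by exact hA), abs_zero]
    positivity

variable {mΩ : MeasurableSpace Ω} {μ : Measure Ω}

lemma truncGenerating_apply (n : ℕ) (ω : Ω) (i j : Fin K) :
    truncGenerating μ C₀ J R n ω i j =
      (μ[fun ω => truncEntry n i j (R (n + 1) ω) | past C₀ J R n]) ω := rfl

/-- The natural filtration of the urn. -/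
def pastFiltration (h : IsRandomizedUrn μ C₀ J R) : Filtration ℕ mΩ where
  seq := past C₀ J R
  mono' := past_mono
  le' := past_le h.measurable_init h.measurable_draw h.measurable_replacement

lemma IsRandomizedUrn.measurable_composition (h : IsRandomizedUrn μ C₀ J R) (n : ℕ) :
    Measurable (composition C₀ J R n) := by
  induction n with
  | zero => exact h.measurable_init
  | succ n ih =>
    refine measurable_pi_iff.2 fun j => ?_
    have h1 : ∀ i, Measurable fun ω => colorIndicator J (n + 1) ω i := fun i =>
      (measurable_pi_apply i).comp (measurable_colorIndicator (h.measurable_draw (n + 1) (by omega)))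
    have h2 : ∀ i, Measurable fun ω => R (n + 1) ω i j := fun i =>
      (measurable_entry i j).comp (h.measurable_replacement (n + 1) (by omega))
    have h3 : Measurable fun ω => composition C₀ J R n ω j := (measurable_pi_apply j).comp ih
    have h4 : Measurable fun ω => composition C₀ J R n ω j +
        ∑ i, colorIndicator J (n + 1) ω i * R (n + 1) ω i j := by fun_prop
    exact h4

lemma IsRandomizedUrn.measurable_totalContent (h : IsRandomizedUrn μ C₀ J R) (n : ℕ) :
    Measurable (totalContent C₀ J R n) :=
  Finset.measurable_fun_sum _ fun i _ => (measurable_pi_apply i).comp (h.measurable_composition n)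

lemma IsRandomizedUrn.ae_nonneg (h : IsRandomizedUrn μ C₀ J R) :
    ∀ᵐ ω ∂μ, ∀ n i, 0 ≤ composition C₀ J R n ω i := by
  have hR : ∀ᵐ ω ∂μ, ∀ n i j, 0 ≤ R (n + 1) ω i j :=
    ae_all_iff.2 fun n => h.replacement_nonneg (n + 1) (by omega)
  filter_upwards [hR, h.init_nonneg] with ω hR h0 n i
  rw [composition_eq_sum]
  exact add_nonneg (h0 i) (Finset.sum_nonneg fun k _ => hR k _ i)

lemma IsRandomizedUrn.ae_pos (h : IsRandomizedUrn μ C₀ J R) :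
    ∀ᵐ ω ∂μ, ∀ n, 0 < totalContent C₀ J R n ω := by
  have hR : ∀ᵐ ω ∂μ, ∀ n i j, 0 ≤ R (n + 1) ω i j :=
    ae_all_iff.2 fun n => h.replacement_nonneg (n + 1) (by omega)
  filter_upwards [hR, h.init_nonneg, h.init_ne_zero] with ω hR h0 hne n
  obtain ⟨i, hi⟩ := Function.ne_iff.1 hne
  have hle : ∀ i, C₀ ω i ≤ composition C₀ J R n ω i := fun i => by
    rw [composition_eq_sum]
    exact le_add_of_nonneg_right (Finset.sum_nonneg fun k _ => hR k _ i)
  exact Finset.sum_pos' (fun j _ => (h0 j).trans (hle j))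
    ⟨i, Finset.mem_univ i, (lt_of_le_of_ne (h0 i) (Ne.symm hi)).trans_le (hle i)⟩

/-- The source of uniform integrability: `S n / n` is dominated by `S 0` plus the averages of the
norms. For `n = 0` the quotients are `0`. -/
lemma IsRandomizedUrn.totalContent_div_le (h : IsRandomizedUrn μ C₀ J R) :
    ∀ᵐ ω ∂μ, ∀ n : ℕ, totalContent C₀ J R n ω / n ≤
      totalContent C₀ J R 0 ω + (∑ k ∈ Finset.range n, ‖R (k + 1) ω‖) / n := by
  filter_upwards [h.ae_pos] with ω h0 n
  rcases Nat.eq_zero_or_pos n with rfl | hn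
  · simpa using (h0 0).le
  have hn1 : (1 : ℝ) ≤ n := by exact_mod_cast hn
  have h1 : totalContent C₀ J R n ω ≤
      totalContent C₀ J R 0 ω + ∑ k ∈ Finset.range n, ‖R (k + 1) ω‖ := by
    simp only [totalContent, composition_eq_sum, Finset.sum_add_distrib]
    rw [Finset.sum_comm (s := Finset.univ)]
    refine add_le_add (by simp) (Finset.sum_le_sum fun k _ => ?_)
    exact (Finset.sum_le_sum fun j _ => le_abs_self _).trans (sum_abs_le_norm _ _)
  calc totalContent C₀ J R n ω / n
      ≤ (totalContent C₀ J R 0 ω + ∑ k ∈ Finset.range n, ‖R (k + 1) ω‖) / n :=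
        div_le_div_of_nonneg_right h1 (by positivity)
    _ ≤ _ := by
        rw [add_div]
        exact add_le_add (div_le_self (h0 0).le hn1) le_rfl

variable [IsProbabilityMeasure μ]

lemma IsRandomizedUrn.tailControl (h : IsRandomizedUrn μ C₀ J R)
    (hTail : NormsMajorized μ R ∨ NormsMomentBounded μ R) :
    TailControl μ fun n ω => ‖R (n + 1) ω‖₊ := by
  have hm : ∀ n, Measurable fun ω => ‖R (n + 1) ω‖₊ := fun n =>
    measurable_nnnorm_matrix.comp (h.measurable_replacement (n + 1) (by omega))
  rcases hTail with ⟨c, hc, ν, hν, -, hint, hle⟩ | ⟨φ, -, ⟨x₀, h1, h2, h3⟩, h4, h5⟩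
  · exact tailControl_of_meas_lt_le hm hint hc fun n x hx => hle (n + 1) (by omega) x hx
  · exact tailControl_of_moment hm h1 h2 h3 h4 h5

/-- The strong law for the truncated replacements: the drawn entries average out to their
predictions `(C n i / S n) * E[truncated entry | past]`. -/
lemma IsRandomizedUrn.ae_tendsto_replacement (h : IsRandomizedUrn μ C₀ J R)
    (hT : TailControl μ fun n ω => ‖R (n + 1) ω‖₊) (i j : Fin K) :
    ∀ᵐ ω ∂μ, Tendsto (fun n : ℕ => (∑ k ∈ Finset.range n,
      (colorIndicator J (k + 1) ω i * truncEntry k i j (R (k + 1) ω) -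
        composition C₀ J R k ω i / totalContent C₀ J R k ω *
          truncGenerating μ C₀ J R k ω i j)) / n) atTop (𝓝 0) := by
  set X : ℕ → Ω → ℝ := fun k ω =>
    colorIndicator J (k + 1) ω i * truncEntry k i j (R (k + 1) ω) with hX
  have hXm : ∀ k, Measurable[past C₀ J R (k + 1)] (X k) := fun k =>
    ((measurable_pi_apply i).comp (measurable_past_colorIndicator k)).mul
      ((measurable_truncEntry k i j).comp (measurable_past_replacement k))
  have hXb : ∀ (k : ℕ) ω, |X k ω| ≤ min ‖R (k + 1) ω‖ (k + 1) := fun k ω => by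
    refine le_trans ?_ (abs_truncEntry_le k i j _)
    simp only [hX, colorIndicator_apply]
    split_ifs <;> simp
  have hce : ∀ k, μ[X k | past C₀ J R k] =ᵐ[μ] fun ω =>
      composition C₀ J R k ω i / totalContent C₀ J R k ω * truncGenerating μ C₀ J R k ω i j := by
    intro k
    have h1 := (h.draw_condIndep k).condExp_indicator_mul
      (past_le h.measurable_init h.measurable_draw h.measurable_replacement k)
      (measurable_colorIndicator (h.measurable_draw (k + 1) (by omega)))
      (h.measurable_replacement (k + 1) (by omega)) (measurableSet_singleton (Pi.single i 1))
      (measurable_truncEntry k i j) (b := k + 1)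
      (fun A => (abs_truncEntry_le k i j A).trans (min_le_right _ _))
    have h2 : X k = (colorIndicator J (k + 1) ⁻¹' {Pi.single i 1}).indicator
        fun ω => truncEntry k i j (R (k + 1) ω) := by
      ext ω
      rw [colorIndicator_preimage]
      by_cases hω : J (k + 1) ω = i <;> simp [hX, colorIndicator_apply, hω]
    rw [h2]
    filter_upwards [h1, h.draw_prob k i] with ω h1 h3
    rw [h1, h3, truncGenerating_apply]
  have hlim := ae_tendsto_average_sub_condExp (μ := μ) (ℱ := pastFiltration h) (X := X)
    (b := fun k => k + 1) (fun k => (hXm k).stronglyMeasurable)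
    (fun k ω => (hXb k ω).trans (min_le_right _ _))
    (hT.summable_sq (fun k => (hXm k).mono
      (past_le h.measurable_init h.measurable_draw h.measurable_replacement (k + 1)) le_rfl) hXb)
  filter_upwards [hlim, ae_all_iff.2 hce] with ω hω hce
  refine hω.congr fun n => ?_
  congr 1
  exact Finset.sum_congr rfl fun k _ => congrArg (X k ω - ·) (hce k)

/-- The strong law for the draws. -/
lemma IsRandomizedUrn.ae_tendsto_draw (h : IsRandomizedUrn μ C₀ J R) (i : Fin K) :
    ∀ᵐ ω ∂μ, Tendsto (fun n : ℕ => (∑ k ∈ Finset.range n,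
      (colorIndicator J (k + 1) ω i -
        composition C₀ J R k ω i / totalContent C₀ J R k ω)) / n) atTop (𝓝 0) := by
  set X : ℕ → Ω → ℝ := fun k ω => colorIndicator J (k + 1) ω i with hX
  have hXm : ∀ k, Measurable[past C₀ J R (k + 1)] (X k) := fun k =>
    (measurable_pi_apply i).comp (measurable_past_colorIndicator k)
  have hXb : ∀ k ω, |X k ω| ≤ 1 := fun k ω => by
    simp only [hX, colorIndicator_apply]
    split_ifs <;> simp
  have hce : ∀ k, μ[X k | past C₀ J R k] =ᵐ[μ] fun ω =>
      composition C₀ J R k ω i / totalContent C₀ J R k ω := by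
    intro k
    have h2 : X k = (colorIndicator J (k + 1) ⁻¹' {Pi.single i 1}).indicator
        fun _ => (1 : ℝ) := by
      ext ω
      rw [colorIndicator_preimage]
      by_cases hω : J (k + 1) ω = i <;> simp [hX, colorIndicator_apply, hω]
    rw [h2]
    exact h.draw_prob k i
  have hsum : Summable fun n : ℕ => (∫ ω, X n ω ^ 2 ∂μ) / ((n : ℝ) + 1) ^ 2 := by
    have hs : Summable fun n : ℕ => 1 / ((n : ℝ) + 1) ^ 2 := by
      have := (summable_nat_add_iff (f := fun n : ℕ => 1 / (n : ℝ) ^ 2) 1).2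
        (Real.summable_one_div_nat_pow.2 one_lt_two)
      simpa using this
    refine Summable.of_nonneg_of_le (fun n => div_nonneg
      (integral_nonneg fun ω => sq_nonneg _) (sq_nonneg _)) (fun n => ?_) hs
    refine div_le_div_of_nonneg_right ?_ (sq_nonneg _)
    have h1 := norm_integral_le_of_norm_le_const (μ := μ) (f := fun ω => X n ω ^ 2) (C := 1)
      (ae_of_all _ fun ω => by
        rw [norm_pow, Real.norm_eq_abs]
        exact pow_le_one₀ (abs_nonneg _) (hXb n ω))
    exact (le_abs_self _).trans (by simpa using h1)
  have hlim := ae_tendsto_average_sub_condExp (μ := μ) (ℱ := pastFiltration h) (X := X)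
    (b := fun _ => 1) (fun k => (hXm k).stronglyMeasurable) hXb hsum
  filter_upwards [hlim, ae_all_iff.2 hce] with ω hω hce
  refine hω.congr fun n => ?_
  congr 1
  exact Finset.sum_congr rfl fun k _ => congrArg (X k ω - ·) (hce k)

end Urn

/-! ### From almost sure convergence to convergence in mean -/

section Mean

variable {Ω : Type*} {mΩ : MeasurableSpace Ω} {μ : Measure Ω} [IsProbabilityMeasure μ]

/-- Vitali's theorem for sequences dominated by an integrable function plus the averages of a
uniformly integrable family. -/
lemma tendstoAEAndL1_of_norm_le {E : Type*} [NormedAddCommGroup E] {X : ℕ → Ω → E} {Y : Ω → E}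
    {G : Ω → ℝ} {Z : ℕ → Ω → ℝ≥0} (hX : ∀ n, AEStronglyMeasurable (X n) μ)
    (hlim : ∀ᵐ ω ∂μ, Tendsto (fun n => X n ω) atTop (𝓝 (Y ω))) (hG : Integrable G μ)
    (hZ : TailControl μ Z)
    (hle : ∀ᵐ ω ∂μ, ∀ n : ℕ, ‖X n ω‖ ≤ G ω + (∑ k ∈ Finset.range n, (Z k ω : ℝ)) / n) :
    TendstoAEAndL1 μ X Y := by
  have hZs : ∀ (s : Set Ω) (a ε : ℝ),
      (∀ k, ∫⁻ ω, ENNReal.ofReal ((Z k ω : ℝ) - a) ∂μ ≤ ENNReal.ofReal ε) →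
      ∀ k, ∫⁻ ω in s, Z k ω ∂μ ≤ ENNReal.ofReal ε + ENNReal.ofReal a * μ s := by
    intro s a ε ha k
    calc ∫⁻ ω in s, Z k ω ∂μ
        ≤ ∫⁻ ω in s, (ENNReal.ofReal ((Z k ω : ℝ) - a) + ENNReal.ofReal a) ∂μ := by
          refine lintegral_mono fun ω => ?_
          rw [← ENNReal.ofReal_coe_nnreal]
          refine le_trans (ENNReal.ofReal_le_ofReal ?_) ENNReal.ofReal_add_le
          linarith
      _ ≤ _ := by
          rw [lintegral_add_right _ measurable_const, setLIntegral_const]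
          exact add_le_add ((setLIntegral_le_lintegral s _).trans (ha k)) le_rfl
  have hbound : ∀ (s : Set Ω) (a ε : ℝ),
      (∀ k, ∫⁻ ω, ENNReal.ofReal ((Z k ω : ℝ) - a) ∂μ ≤ ENNReal.ofReal ε) →
      ∀ n, ∫⁻ ω in s, ‖X n ω‖ₑ ∂μ ≤
        ∫⁻ ω in s, ‖G ω‖ₑ ∂μ + (ENNReal.ofReal ε + ENNReal.ofReal a * μ s) := by
    intro s a ε ha n
    have hZm := hZ.measurable
    calc ∫⁻ ω in s, ‖X n ω‖ₑ ∂μ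
        ≤ ∫⁻ ω in s, (‖G ω‖ₑ + (n : ℝ≥0∞)⁻¹ * ∑ k ∈ Finset.range n, (Z k ω : ℝ≥0∞)) ∂μ := by
          refine lintegral_mono_ae (ae_restrict_of_ae ?_)
          filter_upwards [hle] with ω hω
          rw [← ofReal_norm, ← ofReal_norm]
          refine (ENNReal.ofReal_le_ofReal (hω n)).trans
            (ENNReal.ofReal_add_le.trans (add_le_add (ENNReal.ofReal_le_ofReal (le_abs_self _)) ?_))
          rcases Nat.eq_zero_or_pos n with rfl | hn
          · simp
          have hn' : (0 : ℝ) < n := by exact_mod_cast hn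
          rw [div_eq_inv_mul, ENNReal.ofReal_mul (by positivity), ENNReal.ofReal_inv_of_pos hn',
            ENNReal.ofReal_natCast, ENNReal.ofReal_sum_of_nonneg fun _ _ => NNReal.coe_nonneg _]
          simp
      _ = ∫⁻ ω in s, ‖G ω‖ₑ ∂μ +
            (n : ℝ≥0∞)⁻¹ * ∑ k ∈ Finset.range n, ∫⁻ ω in s, Z k ω ∂μ := by
          rw [lintegral_add_right _ (by fun_prop), lintegral_const_mul _ (by fun_prop),
            lintegral_finsetSum _ fun k _ => by fun_prop]
      _ ≤ _ := by
          refine add_le_add le_rfl ?_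
          rcases Nat.eq_zero_or_pos n with rfl | hn
          · simp
          have hn' : (n : ℝ≥0∞) ≠ 0 := by exact_mod_cast hn.ne'
          calc (n : ℝ≥0∞)⁻¹ * ∑ k ∈ Finset.range n, ∫⁻ ω in s, Z k ω ∂μ
              ≤ (n : ℝ≥0∞)⁻¹ * (n * (ENNReal.ofReal ε + ENNReal.ofReal a * μ s)) := by
                refine mul_le_mul_right ?_ _
                refine (Finset.sum_le_sum fun k _ => hZs s a ε ha k).trans (le_of_eq ?_)
                rw [Finset.sum_const, Finset.card_range, nsmul_eq_mul]
            _ = _ := by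
                rw [← mul_assoc, ENNReal.inv_mul_cancel hn' (ENNReal.natCast_ne_top n), one_mul]
  have hui : UnifIntegrable X 1 μ := by
    intro ε hε
    obtain ⟨a, ha0, ha⟩ := hZ.unif (ε / 3) (by positivity)
    obtain ⟨δ, hδ, hGδ⟩ := (memLp_one_iff_integrable.2 hG).eLpNorm_indicator_le le_rfl
      ENNReal.one_ne_top (show 0 < ε / 3 by positivity)
    refine ⟨min δ (ε / 3 / (a + 1)), by positivity, fun n s hs hμs => ?_⟩
    rw [eLpNorm_indicator_eq_eLpNorm_restrict hs, eLpNorm_one_eq_lintegral_enorm]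
    have h1 : ∫⁻ ω in s, ‖G ω‖ₑ ∂μ ≤ ENNReal.ofReal (ε / 3) := by
      have := hGδ s hs (hμs.trans (ENNReal.ofReal_le_ofReal (min_le_left _ _)))
      rwa [eLpNorm_indicator_eq_eLpNorm_restrict hs, eLpNorm_one_eq_lintegral_enorm] at this
    have h2 : ENNReal.ofReal a * μ s ≤ ENNReal.ofReal (ε / 3) := by
      refine (mul_le_mul_right (hμs.trans
        (ENNReal.ofReal_le_ofReal (min_le_right _ _))) _).trans ?_
      rw [← ENNReal.ofReal_mul ha0]
      refine ENNReal.ofReal_le_ofReal ?_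
      rw [mul_div_assoc', div_le_iff₀ (by positivity)]
      nlinarith
    refine (hbound s a (ε / 3) ha n).trans ?_
    refine (add_le_add h1 (add_le_add le_rfl h2)).trans (le_of_eq ?_)
    rw [← ENNReal.ofReal_add (by positivity) (by positivity),
      ← ENNReal.ofReal_add (by positivity) (by positivity)]
    congr 1
    ring
  have hUI : UniformIntegrable X 1 μ := by
    obtain ⟨a, ha0, ha⟩ := hZ.unif 1 one_pos
    have hfin : ∫⁻ ω, ‖G ω‖ₑ ∂μ + (ENNReal.ofReal 1 + ENNReal.ofReal a * μ Set.univ) ≠ ∞ := by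
      refine ENNReal.add_ne_top.2 ⟨hG.2.ne, ENNReal.add_ne_top.2 ⟨ENNReal.ofReal_ne_top, ?_⟩⟩
      exact ENNReal.mul_ne_top ENNReal.ofReal_ne_top (measure_ne_top μ _)
    refine ⟨hX, hui, (∫⁻ ω, ‖G ω‖ₑ ∂μ +
      (ENNReal.ofReal 1 + ENNReal.ofReal a * μ Set.univ)).toNNReal, fun n => ?_⟩
    rw [ENNReal.coe_toNNReal hfin, eLpNorm_one_eq_lintegral_enorm]
    simpa using hbound Set.univ a 1 ha n
  have hY := hUI.memLp_of_ae_tendsto hlim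
  exact ⟨hlim, fun n => memLp_one_iff_integrable.1 (hUI.memLp n), memLp_one_iff_integrable.1 hY,
    tendsto_Lp_finite_of_tendsto_ae le_rfl ENNReal.one_ne_top hX hY hui hlim⟩

end Mean

/-! ### Convergence of the urn -/

section Convergence

variable {Ω : Type*} {K : ℕ} {C₀ : Ω → Fin K → ℝ} {J : ℕ → Ω → Fin K}
  {R : ℕ → Ω → Matrix (Fin K) (Fin K) ℝ} {mΩ : MeasurableSpace Ω} {μ : Measure Ω}
  [IsProbabilityMeasure μ]

/-- The composition is, up to `o(n)`, the image under the limit matrix of the sum of the past color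
frequencies. -/
lemma IsRandomizedUrn.ae_tendsto_composition_sub (h : IsRandomizedUrn μ C₀ J R)
    (hT : TailControl μ fun n ω => ‖R (n + 1) ω‖₊) {H : Ω → Matrix (Fin K) (Fin K) ℝ}
    (hH_lim : ∀ᵐ ω ∂μ, Tendsto
      (fun n : ℕ => (1 / (n : ℝ)) *
        ∑ k ∈ Finset.range n, ‖truncGenerating μ C₀ J R k ω - H ω‖) atTop (𝓝 0)) :
    ∀ᵐ ω ∂μ, ∀ j, Tendsto (fun n : ℕ => (composition C₀ J R n ω j -
      ((∑ k ∈ Finset.range n, (totalContent C₀ J R k ω)⁻¹ • composition C₀ J R k ω) ᵥ* H ω) j) / n)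
      atTop (𝓝 0) := by
  have hlaw := ae_all_iff.2 fun i => ae_all_iff.2 fun j => h.ae_tendsto_replacement hT i j
  filter_upwards [h.ae_nonneg, h.ae_pos, hT.ae_eventually_le, hlaw, hH_lim] with
    ω hC hS hev hlaw hlim j
  set y : ℕ → Fin K → ℝ := fun k => (totalContent C₀ J R k ω)⁻¹ • composition C₀ J R k ω with hy
  have hy0 : ∀ k i, 0 ≤ y k i := fun k i => mul_nonneg (inv_nonneg.2 (hS k).le) (hC k i)
  have hy1 : ∀ k, ∑ i, y k i = 1 := fun k => by
    simp only [hy, Pi.smul_apply, smul_eq_mul, ← Finset.mul_sum]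
    exact inv_mul_cancel₀ (hS k).ne'
  -- Truncation changes only finitely many of the replacements.
  have h1 : Tendsto (fun n : ℕ => (∑ k ∈ Finset.range n,
      (R (k + 1) ω (J (k + 1) ω) j - truncEntry k (J (k + 1) ω) j (R (k + 1) ω))) / n)
      atTop (𝓝 0) := by
    have h0 : Tendsto (fun k : ℕ => R (k + 1) ω (J (k + 1) ω) j -
        truncEntry k (J (k + 1) ω) j (R (k + 1) ω)) atTop (𝓝 0) := by
      refine tendsto_const_nhds.congr' ?_
      filter_upwards [hev] with k hk
      have hk' : R (k + 1) ω ∈ {A : Matrix (Fin K) (Fin K) ℝ | ‖A‖ ≤ (k + 1 : ℕ)} := by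
        simpa using hk
      rw [truncEntry, Set.indicator_of_mem hk', sub_self]
    exact h0.cesaro.congr fun n => inv_mul_eq_div _ _
  have h2 : Tendsto (fun n : ℕ => ∑ i, (∑ k ∈ Finset.range n,
      (colorIndicator J (k + 1) ω i * truncEntry k i j (R (k + 1) ω) -
        composition C₀ J R k ω i / totalContent C₀ J R k ω *
          truncGenerating μ C₀ J R k ω i j)) / n) atTop (𝓝 0) := by
    simpa using tendsto_finsetSum Finset.univ fun i _ => hlaw i j
  have h3 : Tendsto (fun n : ℕ => (∑ k ∈ Finset.range n,
      ∑ i, y k i * (truncGenerating μ C₀ J R k ω i j - H ω i j)) / n) atTop (𝓝 0) := by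
    refine squeeze_zero_norm (fun n => ?_) hlim
    rw [norm_div, Real.norm_natCast, one_div_mul_eq_div]
    refine div_le_div_of_nonneg_right ((norm_sum_le _ _).trans (Finset.sum_le_sum fun k _ => ?_))
      n.cast_nonneg
    refine (norm_sum_le _ _).trans ?_
    rw [← one_mul ‖_ - _‖, ← hy1 k, Finset.sum_mul]
    refine Finset.sum_le_sum fun i _ => ?_
    rw [norm_mul, Real.norm_of_nonneg (hy0 k i)]
    exact mul_le_mul_of_nonneg_left (abs_le_norm (truncGenerating μ C₀ J R k ω - H ω) i j)
      (hy0 k i)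
  have h4 : Tendsto (fun n : ℕ => C₀ ω j / n) atTop (𝓝 0) :=
    tendsto_const_div_atTop_nhds_zero_nat _
  have h5 := ((h4.add h1).add h2).add h3
  simp only [add_zero] at h5
  refine h5.congr fun n => ?_
  rw [← Finset.sum_div, ← add_div, ← add_div, ← add_div]
  congr 1
  have e1 : ∑ i, ∑ k ∈ Finset.range n,
      (colorIndicator J (k + 1) ω i * truncEntry k i j (R (k + 1) ω) -
        composition C₀ J R k ω i / totalContent C₀ J R k ω * truncGenerating μ C₀ J R k ω i j) =
      ∑ k ∈ Finset.range n, (truncEntry k (J (k + 1) ω) j (R (k + 1) ω) -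
        ∑ i, y k i * truncGenerating μ C₀ J R k ω i j) := by
    rw [Finset.sum_comm]
    refine Finset.sum_congr rfl fun k _ => ?_
    rw [Finset.sum_sub_distrib,
      sum_colorIndicator_mul (k + 1) ω fun i => truncEntry k i j (R (k + 1) ω)]
    congr 1
    refine Finset.sum_congr rfl fun i _ => ?_
    simp only [hy, Pi.smul_apply, smul_eq_mul]
    rw [inv_mul_eq_div]
  have e2 : ((∑ k ∈ Finset.range n, y k) ᵥ* H ω) j =
      ∑ k ∈ Finset.range n, ∑ i, y k i * H ω i j := by
    simp only [Matrix.vecMul, dotProduct, Finset.sum_apply, Finset.sum_mul]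
    rw [Finset.sum_comm]
  rw [e1, e2, composition_eq_sum, add_assoc, add_assoc, add_sub_assoc,
    ← Finset.sum_add_distrib, ← Finset.sum_add_distrib, ← Finset.sum_sub_distrib]
  congr 1
  refine Finset.sum_congr rfl fun k _ => ?_
  simp only [mul_sub, Finset.sum_sub_distrib]
  ring

/-- Almost surely, the urn converges to the quantities given by a Perron triple of the limit. -/
lemma IsRandomizedUrn.ae_tendsto (h : IsRandomizedUrn μ C₀ J R)
    (hT : TailControl μ fun n ω => ‖R (n + 1) ω‖₊) {H : Ω → Matrix (Fin K) (Fin K) ℝ}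
    (hH_irred : ∀ᵐ ω ∂μ, (H ω).IsIrreducible)
    (hH_lim : ∀ᵐ ω ∂μ, Tendsto
      (fun n : ℕ => (1 / (n : ℝ)) *
        ∑ k ∈ Finset.range n, ‖truncGenerating μ C₀ J R k ω - H ω‖) atTop (𝓝 0)) :
    ∀ᵐ ω ∂μ,
      Tendsto (fun n => (totalContent C₀ J R n ω)⁻¹ • composition C₀ J R n ω) atTop
        (𝓝 (perronVector (H ω))) ∧
      Tendsto (fun n : ℕ => totalContent C₀ J R n ω / n) atTop
        (𝓝 (dominantEigenvalue (H ω))) ∧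
      Tendsto (fun n : ℕ => (n : ℝ)⁻¹ • composition C₀ J R n ω) atTop
        (𝓝 (dominantEigenvalue (H ω) • perronVector (H ω))) ∧
      Tendsto (fun n : ℕ => (n : ℝ)⁻¹ • colorCount J n ω) atTop (𝓝 (perronVector (H ω))) := by
  have hdraw := ae_all_iff.2 fun i => h.ae_tendsto_draw i
  filter_upwards [h.ae_nonneg, h.ae_pos, h.ae_tendsto_composition_sub hT hH_lim, hdraw, hH_irred]
    with ω hC hS hsub hdraw hA
  have : Nonempty (Fin K) := ⟨J 0 ω⟩
  obtain ⟨lam, p, r, ht⟩ := hA.exists_isPerronTriple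
  rw [perronVector_eq ht hA, dominantEigenvalue_eq ht hA]
  set y : ℕ → Fin K → ℝ := fun k => (totalContent C₀ J R k ω)⁻¹ • composition C₀ J R k ω with hy
  set v : Fin K → ℝ := (∑ i, p i)⁻¹ • p with hv
  have hp : 0 < ∑ i, p i := Finset.sum_pos (fun i _ => ht.left_pos i) Finset.univ_nonempty
  have hv1 : ∑ i, v i = 1 := by
    simp only [hv, Pi.smul_apply, smul_eq_mul, ← Finset.mul_sum]
    exact inv_mul_cancel₀ hp.ne'
  have hvH : v ᵥ* H ω = lam • v := by rw [hv, Matrix.smul_vecMul, ht.left_eq, smul_comm]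
  have havg : ∀ i, Tendsto (fun n : ℕ => (∑ k ∈ Finset.range n, y k) i / n) atTop (𝓝 (v i)) :=
    ht.tendsto_average hA (S := fun n => totalContent C₀ J R n ω)
      (e := fun n => composition C₀ J R n ω - (∑ k ∈ Finset.range n, y k) ᵥ* H ω)
      (fun k i => mul_nonneg (inv_nonneg.2 (hS k).le) (hC k i))
      (fun k => by
        simp only [hy, Pi.smul_apply, smul_eq_mul, ← Finset.mul_sum]
        exact inv_mul_cancel₀ (hS k).ne')
      hS (fun n => by rw [add_sub_cancel]; exact smul_inv_smul₀ (hS n).ne' _) hsub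
  have hcomp : ∀ j, Tendsto (fun n : ℕ => composition C₀ J R n ω j / n) atTop
      (𝓝 (lam * v j)) := fun j => by
    have h1 : Tendsto (fun n : ℕ => ((∑ k ∈ Finset.range n, y k) ᵥ* H ω) j / n) atTop
        (𝓝 ((v ᵥ* H ω) j)) := by
      refine (tendsto_finsetSum Finset.univ fun i _ => (havg i).mul_const (H ω i j)).congr
        fun n => ?_
      simp only [Matrix.vecMul, dotProduct, Finset.sum_div]
      exact Finset.sum_congr rfl fun i _ => by ring
    have h2 := (hsub j).add h1
    rw [zero_add, hvH] at h2
    exact h2.congr fun n => by ring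
  have htot : Tendsto (fun n : ℕ => totalContent C₀ J R n ω / n) atTop (𝓝 lam) := by
    have h1 := tendsto_finsetSum Finset.univ fun j _ => hcomp j
    rw [← Finset.mul_sum, hv1, mul_one] at h1
    exact h1.congr fun n => by rw [totalContent, Finset.sum_div]
  refine ⟨tendsto_pi_nhds.2 fun i => ?_, htot, tendsto_pi_nhds.2 fun i => ?_,
    tendsto_pi_nhds.2 fun i => ?_⟩
  · have h1 := (hcomp i).div htot ht.pos.ne'
    rw [mul_div_cancel_left₀ _ ht.pos.ne'] at h1
    refine h1.congr' ?_
    filter_upwards [eventually_gt_atTop 0] with n hn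
    have hn' : (n : ℝ) ≠ 0 := by exact_mod_cast hn.ne'
    simp only [Pi.div_apply, hy, Pi.smul_apply, smul_eq_mul]
    rw [div_div_div_cancel_right₀ hn', inv_mul_eq_div]
  · refine (hcomp i).congr fun n => ?_
    rw [Pi.smul_apply, smul_eq_mul, inv_mul_eq_div]
  · have h1 := (hdraw i).add (havg i)
    rw [zero_add] at h1
    refine h1.congr fun n => ?_
    rw [Pi.smul_apply, smul_eq_mul, inv_mul_eq_div, colorCount_apply, ← add_div, Finset.sum_apply,
      ← Finset.sum_add_distrib]
    congr 1
    refine Finset.sum_congr rfl fun k _ => ?_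
    simp only [hy, Pi.smul_apply, smul_eq_mul]
    ring

end Convergence

end RandomUrn

theorem mainTheorem1 {Ω : Type*} [MeasurableSpace Ω] (μ : Measure Ω) [IsProbabilityMeasure μ]
    {K : ℕ} (C₀ : Ω → Fin K → ℝ) (J : ℕ → Ω → Fin K)
    (R : ℕ → Ω → Matrix (Fin K) (Fin K) ℝ)
    (hUrn : RandomUrn.IsRandomizedUrn μ C₀ J R)
    (hTail : RandomUrn.NormsMajorized μ R ∨ RandomUrn.NormsMomentBounded μ R)
    (H : Ω → Matrix (Fin K) (Fin K) ℝ) (hH_meas : Measurable H)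
    (hH_irred : ∀ᵐ ω ∂μ, (H ω).IsIrreducible)
    (hH_lim : ∀ᵐ ω ∂μ, Tendsto
      (fun n : ℕ => (1 / (n : ℝ)) *
        ∑ k ∈ Finset.range n, ‖RandomUrn.truncGenerating μ C₀ J R k ω - H ω‖)
      atTop (𝓝 0)) :
    (∀ᵐ ω ∂μ,
      RandomUrn.IsDominantEigenvalue (H ω) (RandomUrn.dominantEigenvalue (H ω)) ∧
      RandomUrn.IsPerronVector (H ω) (RandomUrn.perronVector (H ω)) ∧
      ∀ v, RandomUrn.IsPerronVector (H ω) v → v = RandomUrn.perronVector (H ω)) ∧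
    RandomUrn.TendstoAEAndL1 μ
      (fun n ω => (RandomUrn.totalContent C₀ J R n ω)⁻¹ • RandomUrn.composition C₀ J R n ω)
      (fun ω => RandomUrn.perronVector (H ω)) ∧
    RandomUrn.TendstoAEAndL1 μ
      (fun n ω => RandomUrn.totalContent C₀ J R n ω / (n : ℝ))
      (fun ω => RandomUrn.dominantEigenvalue (H ω)) ∧
    RandomUrn.TendstoAEAndL1 μ
      (fun n ω => (n : ℝ)⁻¹ • RandomUrn.composition C₀ J R n ω)
      (fun ω => RandomUrn.dominantEigenvalue (H ω) • RandomUrn.perronVector (H ω)) ∧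
    RandomUrn.TendstoAEAndL1 μ
      (fun n ω => (n : ℝ)⁻¹ • RandomUrn.colorCount J n ω)
      (fun ω => RandomUrn.perronVector (H ω)) := by
  have hT := hUrn.tailControl hTail
  have hconv := hUrn.ae_tendsto hT hH_irred hH_lim
  have hC := hUrn.measurable_composition
  have hS := hUrn.measurable_totalContent
  have hG : Integrable (fun ω => RandomUrn.totalContent C₀ J R 0 ω) μ :=
    integrable_finsetSum _ fun i _ => hUrn.init_integrable i
  -- The compositions are dominated by the total content, which is itself dominated by averages.
  have hnorm : ∀ᵐ ω ∂μ, ∀ n, ‖RandomUrn.composition C₀ J R n ω‖ ≤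
      RandomUrn.totalContent C₀ J R n ω := by
    filter_upwards [hUrn.ae_nonneg] with ω hω n
    refine (pi_norm_le_iff_of_nonneg (Finset.sum_nonneg fun i _ => hω n i)).2 fun i => ?_
    rw [Real.norm_of_nonneg (hω n i)]
    exact Finset.single_le_sum (f := fun i => RandomUrn.composition C₀ J R n ω i)
      (fun j _ => hω n j) (Finset.mem_univ i)
  have hone : ∀ {X : ℕ → Ω → Fin K → ℝ}, (∀ᵐ ω ∂μ, ∀ n, ‖X n ω‖ ≤ 1) →
      ∀ᵐ ω ∂μ, ∀ n : ℕ, ‖X n ω‖ ≤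
        (1 : ℝ) + (∑ k ∈ Finset.range n, ((‖R (k + 1) ω‖₊ : ℝ≥0) : ℝ)) / n := by
    intro X hX
    filter_upwards [hX] with ω hω n
    exact (hω n).trans (le_add_of_nonneg_right (by positivity))
  refine ⟨?_, ?_, ?_, ?_, ?_⟩
  · filter_upwards [hH_irred] with ω hA
    have : Nonempty (Fin K) := ⟨J 0 ω⟩
    obtain ⟨lam, p, r, ht⟩ := hA.exists_isPerronTriple
    rw [RandomUrn.perronVector_eq ht hA]
    refine ⟨?_, (RandomUrn.isPerronVector_iff ht hA _).2 rfl,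
      fun v hv => (RandomUrn.isPerronVector_iff ht hA v).1 hv⟩
    rw [RandomUrn.dominantEigenvalue_eq ht hA]
    exact RandomUrn.isDominantEigenvalue_of_isPerronTriple ht hA
  · refine RandomUrn.tendstoAEAndL1_of_norm_le
      (fun n => ((hS n).inv.smul (hC n)).aestronglyMeasurable) (hconv.mono fun ω hω => hω.1)
      (integrable_const 1) hT (hone ?_)
    filter_upwards [hnorm, hUrn.ae_pos] with ω hω hpos n
    rw [norm_smul, norm_inv, Real.norm_of_nonneg (hpos n).le, inv_mul_le_iff₀ (hpos n), mul_one]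
    exact hω n
  · refine RandomUrn.tendstoAEAndL1_of_norm_le
      (fun n => ((hS n).div_const _).aestronglyMeasurable) (hconv.mono fun ω hω => hω.2.1) hG hT ?_
    filter_upwards [hUrn.totalContent_div_le, hUrn.ae_pos] with ω hω hpos n
    rw [Real.norm_of_nonneg (div_nonneg (hpos n).le n.cast_nonneg)]
    exact hω n
  · refine RandomUrn.tendstoAEAndL1_of_norm_le
      (fun n => ((hC n).const_smul (n : ℝ)⁻¹).aestronglyMeasurable) (hconv.mono fun ω hω => hω.2.2.1)
      hG hT ?_
    filter_upwards [hUrn.totalContent_div_le, hnorm] with ω hω hn n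
    rw [norm_smul, norm_inv, Real.norm_natCast, inv_mul_eq_div]
    exact (div_le_div_of_nonneg_right (hn n) n.cast_nonneg).trans (hω n)
  · have hN : ∀ n, Measurable (RandomUrn.colorCount J n) := fun n => by
      refine Finset.measurable_sum _ fun k hk => ?_
      exact RandomUrn.measurable_colorIndicator
        (hUrn.measurable_draw k (Finset.mem_Icc.1 hk).1)
    refine RandomUrn.tendstoAEAndL1_of_norm_le
      (fun n => ((hN n).const_smul (n : ℝ)⁻¹).aestronglyMeasurable) (hconv.mono fun ω hω => hω.2.2.2)
      (integrable_const 1) hT (hone (ae_of_all _ fun ω n => ?_))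
    rw [norm_smul, norm_inv, Real.norm_natCast, inv_mul_eq_div]
    refine div_le_one_of_le₀ ?_ n.cast_nonneg
    refine (pi_norm_le_iff_of_nonneg n.cast_nonneg).2 fun i => ?_
    rw [RandomUrn.colorCount_apply]
    refine (norm_sum_le _ _).trans ?_
    calc ∑ k ∈ Finset.range n, ‖RandomUrn.colorIndicator J (k + 1) ω i‖
        ≤ ∑ _k ∈ Finset.range n, (1 : ℝ) := by
          refine Finset.sum_le_sum fun k _ => ?_
          rw [RandomUrn.colorIndicator_apply]
          split_ifs <;> simp
      _ = n := by simp
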